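/- Let $n\ge 1$, let $V_1,\dots,V_n\in\mathbf Z^n$ be such that the $n\times n$ integer matrix $M=(V_1,\dots,V_n)$ with columns $V_j$ is non-singular, and let $d_1\mid d_2\mid\cdots\mid d_n$ be the invariant factors of $M$: positive integers such that $PMQ=\mathrm{diag}(d_1,\dots,d_n)$ for some $P,Q\in \mathrm{GL}_n(\mathbf Z)$. Let $p$ be a prime with $p\equiv 1 \pmod{d_n}$, let $\mathbf F_q$ be any finite field of characteristic $p$, let $a_1,\dots,a_n\in\mathbf F_q^*$, and let $f(x)=\sum_{j=1}^n a_jx^{V_j}$, where $x^{V_j}=x_1^{v_{1j}}\cdots x_n^{v_{nj}}$ for $V_j=(v_{1j},\dots,v_{nj})$. Then $f$ is ordinary at $p$. Here "ordinary" has the following meaning for a Laurent polynomial $f$ in $n$ variables over $\mathbf F_q$. Fix a primitive $p$-th root of unity $\zeta_p\in\overline{\mathbf Q}_p$, and let $\mathrm{ord}_q$ be the $p$-adic order on $\overline{\mathbf Q}_p$ normalized by $\mathrm{ord}_q(q)=1$. Put $$S_k^*(f)=\sum_{x\in(\mathbf F_{q^k}^*)^n}\zeta_p^{\mathrm{Tr}_{\mathbf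 F_{q^k}/\mathbf F_p}(f(x))},\qquad L^*(f,t)=\exp\Big(\sum_{k\ge1}S_k^*(f)\frac{t^k}{k}\Big).$$ Let $\Delta=\Delta(f)\subset\mathbf R^n$ be the convex hull of the origin and the exponents of $f$. For $u\in\mathbf R^n$ let $w(u)$ be the smallest real $c\ge0$ with $u\in c\Delta$ ($w(u)=\infty$ if there is none). Each codimension $1$ face $\delta$ of $\Delta$ not containing the origin lies on a unique hyperplane $\sum_i e_iX_i=1$ with $e_i\in\mathbf Q$; let $D=D(\Delta)$ be the least common multiple, over all such $\delta$, of the least common denominators of $e_1,\dots,e_n$. For $k\in\mathbf Z$ let $W(k)=\#\{u\in\mathbf Z^n: w(u)=k/D\}$, and let $H(k)=\sum_{i=0}^n(-1)^i\binom niW(k-iD)$. The Hodge polygon $HP(\Delta)$ is the convex polygon with vertices $(0,0)$ and $\big(\sum_{k=0}^mH(k),\ \frac1D\sum_{k=0}^mkH(k)\big)$ for $0\le m\le nD$. The Newton polygon, computed with respect to $q$, of a polynomial $E(t)=\sum_k A_kt^k$ with $A_0=1$ and coefficients in $\overline{\mathbf Q}_p$ is the lower boundary of the convex hull of the points $(k,\mathrm{ord}_q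 A_k)$ with $A_k\ne0$. The Laurent polynomial $f$ is non-degenerate if for every (closed, non-empty) face $\delta$ of $\Delta$ not containing the origin, the partial derivatives $\partial f^\delta/\partial x_1,\dots,\partial f^\delta/\partial x_n$ have no common zero with $x_1\cdots x_n\neq0$ over the algebraic closure of $\mathbf F_q$, where $f^\delta$ is the sum of the terms of $f$ with exponents in $\delta$. Finally, $f$ is ordinary if $f$ is non-degenerate, $\Delta(f)$ is $n$-dimensional, $L^*(f,t)^{(-1)^{n-1}}$ is a polynomial, and the Newton polygon of this polynomial computed with respect to $q$ coincides with $HP(\Delta(f))$. -/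

import Mathlib

noncomputable section

namespace ToricExpSum

/-- Laurent polynomials in `n` variables over `F`; exponents are lattice points of `ℤⁿ`. -/
abbrev Laurent (n : ℕ) (F : Type*) [Field F] : Type _ := AddMonoidAlgebra F (Fin n → ℤ)

/-- A lattice point viewed in `ℝⁿ`. -/
def toReal {n : ℕ} (v : Fin n → ℤ) : Fin n → ℝ := fun i => (v i : ℝ)

section Laurent

variable {n : ℕ} {F : Type*} [Field F]

/-- The value of `f` at a point of the `n`-torus over an extension field `E`. -/
def torusEval {E : Type*} [Field E] [Algebra F E] (f : Laurent n F) (x : Fin n → Eˣ) : E :=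
  ∑ v ∈ f.coeff.support, algebraMap F E (f.coeff v) * ∏ i, ((x i ^ v i : Eˣ) : E)

/-- The formal partial derivative with respect to the `i`-th variable. -/
def partialDeriv (i : Fin n) (f : Laurent n F) : Laurent n F :=
  ∑ v ∈ f.coeff.support,
    AddMonoidAlgebra.single (v - Pi.single i 1) ((v i : F) * f.coeff v)

open Classical in
/-- The restriction `f^δ`: the sum of those terms of `f` whose exponents lie in `δ`. -/
def restrict (δ : Set (Fin n → ℝ)) (f : Laurent n F) : Laurent n F :=
  ∑ v ∈ f.coeff.support with toReal v ∈ δ, AddMonoidAlgebra.single v (f.coeff v)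

/-- The Newton polyhedron `Δ(f)`: the convex hull of the origin and the exponents of `f`. -/
def newtonPolyhedron (f : Laurent n F) : Set (Fin n → ℝ) :=
  convexHull ℝ (insert 0 (toReal '' (f.coeff.support : Set (Fin n → ℤ))))

/-- Non-degeneracy: for each (non-empty, closed) face `δ` of `Δ(f)` not containing the origin, the
partial derivatives of `f^δ` have no common zero on the torus over the algebraic closure.
(The faces of a polytope are its exposed subsets.) -/
def NonDegenerate (f : Laurent n F) : Prop :=
  ∀ δ : Set (Fin n → ℝ), IsExposed ℝ (newtonPolyhedron f) δ → δ.Nonempty → 0 ∉ δ →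
    ¬ ∃ x : Fin n → (AlgebraicClosure F)ˣ, ∀ i, torusEval (partialDeriv i (restrict δ f)) x = 0

/-- The diagonal Laurent polynomial `∑ⱼ aⱼ x^{Vⱼ}`, where `Vⱼ` is the `j`-th column of `M`. -/
def diagonal (M : Matrix (Fin n) (Fin n) ℤ) (a : Fin n → F) : Laurent n F :=
  ∑ j, AddMonoidAlgebra.single (fun i => M i j) (a j)

end Laurent

section LFunction

variable {n : ℕ} (p : ℕ) [Fact p.Prime] {F : Type*} [Field F] [Finite F] [CharP F p]

/-- The exponential sum `S_k^*(f) = ∑ ζ^{Tr_k f(x)}`, over all points `x` of the `n`-torus over the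
degree `k` extension of the finite field `F`; `Tr_k` is the trace to the prime field. -/
def expSum (ζ : PadicAlgCl p) (f : Laurent n F) (k : ℕ) [NeZero k] : PadicAlgCl p :=
  letI : Fintype (Fin n → (FiniteField.Extension F p k)ˣ) := Fintype.ofFinite _
  ∑ x : Fin n → (FiniteField.Extension F p k)ˣ,
    ζ ^ (Algebra.trace (ZMod p) (FiniteField.Extension F p k) (torusEval f x)).val

/-- The power series `∑_{k ≥ 1} S_k^*(f) t^k / k`. -/
def logLFunction (ζ : PadicAlgCl p) (f : Laurent n F) : PowerSeries (PadicAlgCl p) :=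
  PowerSeries.X * PowerSeries.mk fun k => expSum p ζ f (k + 1) / ((k + 1 : ℕ) : PadicAlgCl p)

/-- The L-function `L^*(f, t) = exp (∑_{k ≥ 1} S_k^*(f) t^k / k)`. -/
def LFunction (ζ : PadicAlgCl p) (f : Laurent n F) : PowerSeries (PadicAlgCl p) :=
  (PowerSeries.exp (PadicAlgCl p)).subst (logLFunction p ζ f)

/-- `L^*(f, t)^{(-1)^{n-1}}`. -/
def signedLFunction (ζ : PadicAlgCl p) (f : Laurent n F) : PowerSeries (PadicAlgCl p) :=
  if Even n then (LFunction p ζ f)⁻¹ else LFunction p ζ f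

end LFunction

section Polygons

/-- The lower boundary of the convex hull of a set of points in the plane. -/
def lowerHull (S : Set (ℝ × ℝ)) : Set (ℝ × ℝ) :=
  {z | z ∈ convexHull ℝ S ∧ ∀ w ∈ convexHull ℝ S, w.1 = z.1 → z.2 ≤ w.2}

/-- The `p`-adic order normalized by `ord_q q = 1` (used only for `x ≠ 0`). -/
def ordQ (p : ℕ) [Fact p.Prime] (q : ℕ) (x : PadicAlgCl p) : ℝ :=
  -(Real.log ‖x‖ / Real.log q)

/-- The Newton polygon, computed with respect to `q`: the convex closure from below of the points
`(k, ord_q a_k)`. Points with `a_k = 0` have infinite order and do not contribute. -/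
def newtonPolygon (p : ℕ) [Fact p.Prime] (q : ℕ) (E : PowerSeries (PadicAlgCl p)) :
    Set (ℝ × ℝ) :=
  lowerHull {z | ∃ k : ℕ, PowerSeries.coeff k E ≠ 0 ∧
    z = ((k : ℝ), ordQ p q (PowerSeries.coeff k E))}

variable {n : ℕ}

open Pointwise in
/-- The weight `w(u)`: the smallest real `c ≥ 0` with `u ∈ cΔ`, and `∞` if there is none. -/
def weight (Δ : Set (Fin n → ℝ)) (u : Fin n → ℝ) : EReal :=
  ⨅ c ∈ {c : ℝ | 0 ≤ c ∧ u ∈ c • Δ}, (c : EReal)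

/-- `∑ eᵢ Xᵢ = 1` is the equation of (the hyperplane spanned by) a codimension one face of `Δ` not
containing the origin. Here `Δ` is a polytope containing the origin: the hyperplane supports `Δ`,
and the face it cuts out, which avoids the origin, has dimension `n - 1`, that is, its linear
span is everything. -/
def IsFacetEquation (Δ : Set (Fin n → ℝ)) (e : Fin n → ℝ) : Prop :=
  (∀ x ∈ Δ, ∑ i, e i * x i ≤ 1) ∧ Submodule.span ℝ {x ∈ Δ | ∑ i, e i * x i = 1} = ⊤

/-- The denominator `D(Δ)`: the least common multiple, over all codimension one faces of `Δ` not
containing the origin, of the least common denominators of the coefficients `eᵢ` of their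
equations; i.e. the least positive integer that clears the denominators of all these `eᵢ`. -/
def denominator (Δ : Set (Fin n → ℝ)) : ℕ :=
  sInf {m : ℕ | 0 < m ∧ ∀ e, IsFacetEquation Δ e → ∀ i, ∃ z : ℤ, (m : ℝ) * e i = z}

/-- `W(k)`: the number of lattice points of weight `k / D(Δ)` (zero for negative `k`). -/
def weightCount (Δ : Set (Fin n → ℝ)) (k : ℤ) : ℕ :=
  Set.ncard {u : Fin n → ℤ | weight Δ (toReal u) = (((k : ℝ) / (denominator Δ : ℝ) : ℝ) : EReal)}

/-- `H(k) = ∑_{i=0}^n (-1)^i (n choose i) W(k - i D(Δ))`. -/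
def hodgeNumber (Δ : Set (Fin n → ℝ)) (k : ℕ) : ℤ :=
  ∑ i ∈ Finset.range (n + 1),
    (-1) ^ i * (n.choose i : ℤ) * (weightCount Δ ((k : ℤ) - (i : ℤ) * (denominator Δ : ℤ)) : ℤ)

/-- The Hodge polygon `HP(Δ)`: the convex polygon with vertices `(0, 0)` and
`(∑_{k ≤ m} H(k), D(Δ)⁻¹ ∑_{k ≤ m} k H(k))` for `0 ≤ m ≤ n D(Δ)`. -/
def hodgePolygon (Δ : Set (Fin n → ℝ)) : Set (ℝ × ℝ) :=
  lowerHull (insert (0, 0) {z | ∃ m ≤ n * denominator Δ,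
    z = (∑ k ∈ Finset.range (m + 1), (hodgeNumber Δ k : ℝ),
      (∑ k ∈ Finset.range (m + 1), (k : ℝ) * (hodgeNumber Δ k : ℝ)) / (denominator Δ : ℝ))})

end Polygons

/-- `f`, a Laurent polynomial over the field `F` with `q` elements, is ordinary: `f` is
non-degenerate, `Δ(f)` is `n`-dimensional, `L^*(f, t)^{(-1)^{n-1}}` is a polynomial, and its Newton
polygon computed with respect to `q` coincides with the Hodge polygon of `Δ(f)`. -/
structure IsOrdinary {n : ℕ} (p : ℕ) [Fact p.Prime] {F : Type*} [Field F] [Finite F] [CharP F p]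
    (ζ : PadicAlgCl p) (f : Laurent n F) : Prop where
  nonDegenerate : NonDegenerate f
  fullDimensional : affineSpan ℝ (newtonPolyhedron f) = ⊤
  polynomial : ∃ P : Polynomial (PadicAlgCl p),
    (P : PowerSeries (PadicAlgCl p)) = signedLFunction p ζ f
  polygons_eq : newtonPolygon p (Nat.card F) (signedLFunction p ζ f) =
    hodgePolygon (newtonPolyhedron f)

/-- `d₁ ∣ d₂ ∣ ⋯ ∣ dₙ` are the invariant factors of the integral matrix `M`: there are
`P, Q ∈ GLₙ(ℤ)` such that `P M Q = diag(d₁, …, dₙ)`. -/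
def IsInvariantFactors {n : ℕ} (M : Matrix (Fin n) (Fin n) ℤ) (d : Fin n → ℕ) : Prop :=
  (∀ i j, i ≤ j → d i ∣ d j) ∧
    ∃ P Q : Matrix.GeneralLinearGroup (Fin n) ℤ,
      (P : Matrix (Fin n) (Fin n) ℤ) * M * (Q : Matrix (Fin n) (Fin n) ℤ) =
        Matrix.diagonal fun i => (d i : ℤ)

end ToricExpSum

end

noncomputable section

namespace ToricExpSum

open Finset

/-! ### Lower hulls -/

/-! Write `P M Q = diag(d_i)`. A change of variables on the torus turns the monomials `x^{V_j}` into
`d_i`-th powers followed by a unimodular map. Detecting `d_i`-th powers with multiplicative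
characters makes each `S_k^*(f)` a sum, over tuples `s` with `0 ≤ s_i < d_i`, of products of `n`
Gauss sums (`sum_torus_eq_sum_prod`). Since `d_i ∣ d_n ∣ p - 1`, every character that occurs factors
through the norm to `F_p`, for all `k` at once. Hasse–Davenport then makes each product, up to the
sign `(-1)^n`, the `k`-th power of a number `c_s` independent of `k` (`expSum_diagonal`). Hence the
signed L-function is `∏_s (1 - c_s t)` (`signedLFunction_eq_prod`).

Only Gauss sums over the prime field remain, and Stickelberger (`norm_gauss_sum`) gives `ord_q c_s =
∑_j e_j(s)/(p-1)`. Here `e_j(s)/(p-1)` is the fractional part of the `j`-th coordinate of `Q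
(s_i/d_i)_i`. These vectors are exactly the coordinates, in the basis `V_1, …, V_n`, of the lattice
points of the half-open parallelepiped spanned by the columns (`exists_boxPoint`).

On the Hodge side `Δ` is a simplex, the weight on its cone is the sum of these coordinates, and the
alternating sum defining `H(k)` is an inclusion–exclusion that counts the parallelepiped points of
weight `k/D` (`hodgeNumber_eq_ncard`). So the slopes `ord_q c_s` are the Hodge slopes with the same
multiplicities (`exists_weight`), and `newtonPolygon_prod` identifies the polygons. Non-degeneracy
is invertibility of `M` modulo `p`, because `det M = ± ∏ d_i` is prime to `p`. -/

/-- The points lying on or above some point of `conv B` form a convex set, so once it contains `S`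
it contains `conv S`. -/
theorem lowerHull_eq_of_dominates {B S : Set (ℝ × ℝ)} (hBS : B ⊆ S)
    (h : ∀ z ∈ S, ∃ w ∈ convexHull ℝ B, w.1 = z.1 ∧ w.2 ≤ z.2) :
    lowerHull S = lowerHull B := by
  have hsub : convexHull ℝ B ⊆ convexHull ℝ S := convexHull_mono hBS
  have hdom : convexHull ℝ S ⊆ {z | ∃ w ∈ convexHull ℝ B, w.1 = z.1 ∧ w.2 ≤ z.2} := by
    refine convexHull_min h ?_
    rintro x ⟨x', hx', hx1, hx2⟩ y ⟨y', hy', hy1, hy2⟩ a b ha hb hab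
    refine ⟨a • x' + b • y', convex_convexHull ℝ B hx' hy' ha hb hab, ?_, ?_⟩
    · simp [hx1, hy1]
    · simp only [Prod.snd_add, Prod.smul_snd, smul_eq_mul]
      gcongr
  ext z
  constructor
  · rintro ⟨hz, hmin⟩
    obtain ⟨w, hw, hw1, hw2⟩ := hdom hz
    have : z = w := Prod.ext hw1.symm (le_antisymm (hmin w (hsub hw) hw1) hw2)
    subst this
    exact ⟨hw, fun v hv hv1 => hmin v (hsub hv) hv1⟩
  · rintro ⟨hz, hmin⟩
    refine ⟨hsub hz, fun v hv hv1 => ?_⟩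
    obtain ⟨w, hw, hw1, hw2⟩ := hdom hv
    exact (hmin w hw (hw1.trans hv1)).trans hw2

theorem mem_convexHull_of_between {B : Set (ℝ × ℝ)} {P Q : ℝ × ℝ} (hP : P ∈ B) (hQ : Q ∈ B)
    {α β x : ℝ} (hP2 : P.2 = α + β * P.1) (hQ2 : Q.2 = α + β * Q.1) (h1 : P.1 ≤ x)
    (h2 : x ≤ Q.1) : (x, α + β * x) ∈ convexHull ℝ B := by
  rcases eq_or_lt_of_le (h1.trans h2) with h | h
  · have hx : x = P.1 := le_antisymm (h2.trans h.ge) h1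
    have : (x, α + β * x) = P := Prod.ext hx (by rw [hP2, hx])
    exact this ▸ subset_convexHull ℝ B hP
  · have hpos : 0 < Q.1 - P.1 := sub_pos.2 h
    have := convex_convexHull ℝ B (subset_convexHull ℝ B hP) (subset_convexHull ℝ B hQ)
      (div_nonneg (sub_nonneg.2 h2) hpos.le) (div_nonneg (sub_nonneg.2 h1) hpos.le)
      (by field_simp; ring)
    convert this using 1
    refine Prod.ext ?_ ?_
    · simp only [Prod.fst_add, Prod.smul_fst, smul_eq_mul]
      field_simp
      ring
    · simp only [Prod.snd_add, Prod.smul_snd, smul_eq_mul, hP2, hQ2]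
      field_simp
      ring

/-! ### The order function -/

section Ord

variable {p : ℕ} [Fact p.Prime] {q : ℕ}

theorem ordQ_le_iff (hq : 1 < q) {x y : PadicAlgCl p} (hx : x ≠ 0) (hy : y ≠ 0) :
    ordQ p q x ≤ ordQ p q y ↔ ‖y‖ ≤ ‖x‖ := by
  have hlog : 0 < Real.log q := Real.log_pos (by exact_mod_cast hq)
  rw [ordQ, ordQ, neg_le_neg_iff, div_le_div_iff_of_pos_right hlog,
    Real.log_le_log_iff (norm_pos_iff.2 hy) (norm_pos_iff.2 hx)]

theorem ordQ_neg (x : PadicAlgCl p) : ordQ p q (-x) = ordQ p q x := by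
  rw [ordQ, ordQ, norm_neg]

theorem ordQ_prod {ι : Type*} (s : Finset ι) {f : ι → PadicAlgCl p} (hf : ∀ i ∈ s, f i ≠ 0) :
    ordQ p q (∏ i ∈ s, f i) = ∑ i ∈ s, ordQ p q (f i) := by
  simp only [ordQ, norm_prod]
  rw [Real.log_prod (fun i hi => norm_ne_zero_iff.2 (hf i hi)), Finset.sum_div,
    Finset.sum_neg_distrib]

theorem exists_ordQ_le_ordQ_sum (hq : 1 < q) {ι : Type*} {s : Finset ι} {f : ι → PadicAlgCl p}
    (hf : ∀ i ∈ s, f i ≠ 0) (h : ∑ i ∈ s, f i ≠ 0) :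
    ∃ i ∈ s, ordQ p q (f i) ≤ ordQ p q (∑ i ∈ s, f i) := by
  have hs : s.Nonempty := by
    rw [Finset.nonempty_iff_ne_empty]
    rintro rfl
    simp at h
  obtain ⟨i, hi, hle⟩ := IsUltrametricDist.exists_norm_finsetSum_le_of_nonempty hs f
  exact ⟨i, hi, (ordQ_le_iff hq (hf i hi) h).2 hle⟩

/-- In an ultrametric sum a unique term of least order dominates, so no cancellation can affect it.
-/
theorem ordQ_sum_of_lt (hq : 1 < q) {ι : Type*} [DecidableEq ι] {s : Finset ι}
    {f : ι → PadicAlgCl p}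
    (hf : ∀ i ∈ s, f i ≠ 0) {a : ι} (ha : a ∈ s)
    (hlt : ∀ i ∈ s, i ≠ a → ordQ p q (f a) < ordQ p q (f i)) :
    ∑ i ∈ s, f i ≠ 0 ∧ ordQ p q (∑ i ∈ s, f i) = ordQ p q (f a) := by
  have hnorm : ‖∑ i ∈ s, f i‖ = ‖f a‖ := by
    have hlt' : ‖∑ i ∈ s.erase a, f i‖ < ‖f a‖ := by
      by_cases h0 : ∑ i ∈ s.erase a, f i = 0
      · rw [h0, norm_zero]
        exact norm_pos_iff.2 (hf a ha)
      obtain ⟨i, hi, hle⟩ := exists_ordQ_le_ordQ_sum hq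
        (fun i hi => hf i (Finset.mem_of_mem_erase hi)) h0
      rw [Finset.mem_erase] at hi
      by_contra hcon
      have := (ordQ_le_iff hq h0 (hf a ha)).2 (not_lt.1 hcon)
      exact absurd ((hlt i hi.2 hi.1).trans_le hle) (not_lt.2 this)
    rw [← Finset.add_sum_erase s f ha, IsUltrametricDist.norm_add_eq_max_of_norm_ne_norm hlt'.ne',
      max_eq_left hlt'.le]
  refine ⟨norm_ne_zero_iff.1 (hnorm ▸ norm_ne_zero_iff.2 (hf a ha)), ?_⟩
  rw [ordQ, ordQ, hnorm]

end Ord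

/-! ### Newton polygons of products of linear factors -/

theorem coeff_prod_one_sub_C_mul_X {K R : Type*} [CommRing K] [Fintype R] (c : R → K) (k : ℕ) :
    PowerSeries.coeff k (∏ r, (1 - PowerSeries.C (c r) * PowerSeries.X)) =
      ∑ T ∈ powersetCard k univ, ∏ r ∈ T, -c r := by
  classical
  have h1 : ∏ r, (1 - PowerSeries.C (c r) * PowerSeries.X) =
      ∑ T ∈ (univ : Finset R).powerset,
        PowerSeries.C (∏ r ∈ T, -c r) * PowerSeries.X ^ T.card := by
    simp_rw [sub_eq_add_neg]
    rw [Finset.prod_one_add]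
    refine Finset.sum_congr rfl fun T _ => ?_
    rw [map_prod, ← Finset.prod_const, ← Finset.prod_mul_distrib]
    simp
  rw [h1, map_sum, Finset.powersetCard_eq_filter, Finset.sum_filter]
  refine Finset.sum_congr rfl fun T _ => ?_
  rw [PowerSeries.coeff_C_mul_X_pow]
  simp only [eq_comm]

section Sums

variable {R : Type*} [Fintype R] (κ : R → ℕ) (m : ℕ)

/-- The sublevel set collects every nonpositive term `κ r - m` and no positive one. Subtracting `m`
is what allows a comparison with sets `T` of any size, and so bounds coefficients between
breakpoints. -/
theorem sum_min_le_sum (T : Finset R) :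
    ∑ r ∈ univ.filter (fun r => κ r ≤ m), ((κ r : ℤ) - m) ≤ ∑ r ∈ T, ((κ r : ℤ) - m) := by
  classical
  have h : ∑ r ∈ univ.filter (fun r => κ r ≤ m), ((κ r : ℤ) - m) =
      ∑ r, min ((κ r : ℤ) - m) 0 := by
    rw [Finset.sum_filter]
    refine Finset.sum_congr rfl fun r _ => ?_
    split_ifs with h <;> omega
  rw [h, ← Finset.sum_add_sum_compl T]
  have h1 : ∑ r ∈ T, min ((κ r : ℤ) - m) 0 ≤ ∑ r ∈ T, ((κ r : ℤ) - m) :=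
    Finset.sum_le_sum fun r _ => min_le_left _ _
  have h2 : ∑ r ∈ Tᶜ, min ((κ r : ℤ) - m) 0 ≤ 0 :=
    Finset.sum_nonpos fun r _ => min_le_right _ _
  omega

theorem sum_lt_sum_of_ne {T : Finset R} (hcard : T.card = (univ.filter fun r => κ r ≤ m).card)
    (hne : T ≠ univ.filter fun r => κ r ≤ m) :
    ∑ r ∈ univ.filter (fun r => κ r ≤ m), κ r < ∑ r ∈ T, κ r := by
  classical
  obtain ⟨r, hrT, hr⟩ : ∃ r ∈ T, r ∉ univ.filter fun r => κ r ≤ m := by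
    by_contra! hcon
    exact hne (Finset.eq_of_subset_of_card_le hcon hcard.ge)
  have h1 := sum_min_le_sum κ m (T.erase r)
  have h2 := Finset.add_sum_erase T (fun r => (κ r : ℤ) - m) hrT
  have hr' : m < κ r := by simpa using hr
  have h3 : ∑ r ∈ univ.filter (fun r => κ r ≤ m), ((κ r : ℤ) - m) < ∑ r ∈ T, ((κ r : ℤ) - m) := by
    omega
  simp only [Finset.sum_sub_distrib, Finset.sum_const, hcard] at h3
  exact_mod_cast sub_lt_sub_iff_right _ |>.1 h3

end Sums

/-- The slopes are the orders of the reciprocal zeros. At a breakpoint one monomial of the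
elementary symmetric function dominates; elsewhere the ultrametric inequality gives a lower bound,
which is all a lower hull needs. Levels `m` not attained by `κ` only repeat points. -/
theorem newtonPolygon_prod {p : ℕ} [Fact p.Prime] {q : ℕ} (hq : 1 < q) {R : Type*} [Fintype R]
    (c : R → PadicAlgCl p) (hc : ∀ r, c r ≠ 0) (κ : R → ℕ) {D N : ℕ} (hD : 0 < D)
    (hκ : ∀ r, ordQ p q (c r) = κ r / D) (hN : ∀ r, κ r ≤ N) :
    newtonPolygon p q (∏ r, (1 - PowerSeries.C (c r) * PowerSeries.X)) =
      lowerHull (insert (0, 0) {z | ∃ m ≤ N, z = (((univ.filter fun r => κ r ≤ m).card : ℝ),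
        (∑ r ∈ univ.filter (fun r => κ r ≤ m), (κ r : ℝ)) / D)}) := by
  classical
  have hDpos : (0 : ℝ) < D := by exact_mod_cast hD
  have hne : ∀ T : Finset R, ∏ r ∈ T, -c r ≠ 0 := fun T =>
    Finset.prod_ne_zero_iff.2 fun r _ => neg_ne_zero.2 (hc r)
  have hord : ∀ T : Finset R, ordQ p q (∏ r ∈ T, -c r) = (∑ r ∈ T, (κ r : ℝ)) / D := by
    intro T
    rw [ordQ_prod _ fun r _ => neg_ne_zero.2 (hc r), Finset.sum_div]
    exact Finset.sum_congr rfl fun r _ => by rw [ordQ_neg, hκ]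
  refine lowerHull_eq_of_dominates ?_ ?_
  · rintro z (rfl | ⟨m, -, rfl⟩)
    · refine ⟨0, ?_⟩
      rw [coeff_prod_one_sub_C_mul_X]
      simp [ordQ]
    · refine ⟨(univ.filter fun r => κ r ≤ m).card, ?_⟩
      rw [coeff_prod_one_sub_C_mul_X]
      -- The sublevel set is the unique subset of its cardinality with least total order.
      have := ordQ_sum_of_lt hq (s := powersetCard (univ.filter fun r => κ r ≤ m).card univ)
        (f := fun T => ∏ r ∈ T, -c r) (fun T _ => hne T)
        (a := univ.filter fun r => κ r ≤ m) (by simp) (by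
          intro T hT hTne
          rw [hord, hord, div_lt_div_iff_of_pos_right hDpos]
          exact_mod_cast sum_lt_sum_of_ne κ m (Finset.mem_powersetCard.1 hT).2 hTne)
      refine ⟨this.1, ?_⟩
      rw [this.2, hord]
  · rintro z ⟨k, hk, rfl⟩
    rw [coeff_prod_one_sub_C_mul_X] at hk ⊢
    obtain ⟨T, hT, hle⟩ := exists_ordQ_le_ordQ_sum hq (fun T _ => hne T) hk
    have hTk : T.card = k := (Finset.mem_powersetCard.1 hT).2
    have hex : ∃ m, k ≤ (univ.filter fun r => κ r ≤ m).card := by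
      refine ⟨N, ?_⟩
      rw [Finset.filter_true_of_mem fun r _ => hN r, ← hTk]
      exact Finset.card_le_univ T
    -- With this least `m`, the abscissa `k` lies between `#{κ < m}` and `#{κ ≤ m}`, the ends of an
    -- edge of slope `m / D`.
    set m := Nat.find hex with hm
    have hmN : m ≤ N := by
      refine Nat.find_le_iff hex N |>.2 ⟨N, le_rfl, ?_⟩
      rw [Finset.filter_true_of_mem fun r _ => hN r, ← hTk]
      exact Finset.card_le_univ T
    have hkm : k ≤ (univ.filter fun r => κ r ≤ m).card := Nat.find_spec hex
    set B : Set (ℝ × ℝ) := insert (0, 0) {z | ∃ m ≤ N, z =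
      (((univ.filter fun r => κ r ≤ m).card : ℝ),
        (∑ r ∈ univ.filter (fun r => κ r ≤ m), (κ r : ℝ)) / D)}
    have hQ : (((univ.filter fun r => κ r ≤ m).card : ℝ),
        (∑ r ∈ univ.filter (fun r => κ r ≤ m), (κ r : ℝ)) / D) ∈ B := Or.inr ⟨m, hmN, rfl⟩
    have hP : (((univ.filter fun r => κ r < m).card : ℝ),
        (∑ r ∈ univ.filter (fun r => κ r < m), (κ r : ℝ)) / D) ∈ B := by
      rcases Nat.eq_zero_or_pos m with h0 | h0
      · left
        simp [h0]
      · right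
        refine ⟨m - 1, by omega, ?_⟩
        have : ∀ r, κ r < m ↔ κ r ≤ m - 1 := fun r => by omega
        simp only [this]
    have hPk : (univ.filter fun r => κ r < m).card ≤ k := by
      rcases Nat.eq_zero_or_pos m with h0 | h0
      · simp [h0]
      · have := Nat.find_min hex (m := m - 1) (by omega)
        have h' : ∀ r, κ r < m ↔ κ r ≤ m - 1 := fun r => by omega
        simp only [h']
        omega
    -- `A / D` is the intercept of the line carrying that edge. Indices with `κ r = m` contribute
    -- zero, so both ends give the same `A`.
    set A : ℝ := ∑ r ∈ univ.filter (fun r => κ r ≤ m), ((κ r : ℝ) - m) with hA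
    have hA' : A = ∑ r ∈ univ.filter (fun r => κ r < m), ((κ r : ℝ) - m) := by
      rw [hA, Finset.sum_filter, Finset.sum_filter]
      refine Finset.sum_congr rfl fun r _ => ?_
      rcases lt_trichotomy (κ r) m with h | h | h
      · simp [h, h.le]
      · simp [h]
      · simp [h.not_ge, h.not_gt]
    refine ⟨((k : ℝ), A / D + (m : ℝ) / D * k), ?_, rfl, ?_⟩
    · refine mem_convexHull_of_between hP hQ ?_ ?_ (Nat.cast_le.2 hPk) (Nat.cast_le.2 hkm)
      · simp only [hA', Finset.sum_sub_distrib, Finset.sum_const, nsmul_eq_mul]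
        field_simp
        ring
      · simp only [hA, Finset.sum_sub_distrib, Finset.sum_const, nsmul_eq_mul]
        field_simp
        ring
    · refine le_trans ?_ hle
      rw [hord]
      have h1 : A ≤ ∑ r ∈ T, ((κ r : ℝ) - m) := by
        have := sum_min_le_sum κ m T
        rw [hA]
        exact_mod_cast this
      simp only [Finset.sum_sub_distrib, Finset.sum_const, nsmul_eq_mul, hTk] at h1
      have h2 : A / D + (m : ℝ) / D * k = (A + k * m) / D := by ring
      rw [h2, div_le_div_iff_of_pos_right hDpos]
      linarith

/-! ### The Hasse–Davenport relation -/

section HasseDavenport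

open Polynomial

variable {K C : Type*} [Field K] [Field C]

variable (χ : MulChar K C) (ψ : AddChar K C)

/-- The completely multiplicative function on monic polynomials attached to a multiplicative and
an additive character. -/
def polyChar (f : K[X]) : C := χ ((-1) ^ f.natDegree * f.coeff 0) * ψ (-f.nextCoeff)

theorem polyChar_one : polyChar χ ψ 1 = 1 := by
  simp [polyChar, nextCoeff]

/-- For monic `f` the two arguments are the product and the sum of the roots, which are respectively
multiplicative and additive in `f`. -/
theorem polyChar_mul {f g : K[X]} (hf : f.Monic) (hg : g.Monic) :
    polyChar χ ψ (f * g) = polyChar χ ψ f * polyChar χ ψ g := by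
  rw [polyChar, hf.natDegree_mul hg, hf.nextCoeff_mul hg, mul_coeff_zero, pow_add, neg_add,
    AddChar.map_add_eq_mul, polyChar, polyChar, mul_mul_mul_comm, map_mul, mul_mul_mul_comm]

theorem polyChar_pow {f : K[X]} (hf : f.Monic) (j : ℕ) :
    polyChar χ ψ (f ^ j) = polyChar χ ψ f ^ j := by
  induction j with
  | zero => simp [polyChar_one]
  | succ j ih => rw [pow_succ, polyChar_mul χ ψ (hf.pow j) hf, ih, pow_succ]

theorem finite_monic_natDegree (K : Type*) [Field K] [Finite K] (m : ℕ) :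
    {f : K[X] | f.Monic ∧ f.natDegree = m}.Finite :=
  Set.finite_coe_iff.1 (Finite.of_equiv _
    ((monicEquivDegreeLT m).trans (degreeLTEquiv K m).toEquiv).symm)

/-- The monic polynomials of degree `m` over a finite field. -/
def monics (K : Type*) [Field K] [Finite K] (m : ℕ) : Finset K[X] :=
  (finite_monic_natDegree K m).toFinset

variable [Finite K]

theorem mem_monics {m : ℕ} {f : K[X]} : f ∈ monics K m ↔ f.Monic ∧ f.natDegree = m := by
  simp [monics]

open Classical in
/-- The monic irreducible polynomials whose degree lies between `1` and `m`. -/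
def monicIrreducibles (K : Type*) [Field K] [Finite K] (m : ℕ) : Finset K[X] :=
  ((Finset.Icc 1 m).biUnion (monics K)).filter Irreducible

theorem mem_monicIrreducibles {m : ℕ} {P : K[X]} :
    P ∈ monicIrreducibles K m ↔ P.Monic ∧ Irreducible P ∧ P.natDegree ≤ m := by
  simp only [monicIrreducibles, mem_filter, mem_biUnion, mem_monics, mem_Icc]
  constructor
  · rintro ⟨⟨i, ⟨-, h⟩, h1, h2⟩, h3⟩
    exact ⟨h1, h3, h2.trans_le h⟩
  · rintro ⟨h1, h2, h3⟩
    exact ⟨⟨_, ⟨h2.natDegree_pos, h3⟩, h1, rfl⟩, h2⟩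

theorem sum_monics_zero : ∑ f ∈ monics K 0, polyChar χ ψ f = 1 := by
  have : monics K 0 = {1} := by
    ext f
    rw [mem_monics, mem_singleton]
    refine ⟨fun h => h.1.natDegree_eq_zero.1 h.2, ?_⟩
    rintro rfl
    simp
  rw [this, sum_singleton, polyChar_one]

theorem sum_monics_one [Fintype K] :
    ∑ f ∈ monics K 1, polyChar χ ψ f = ∑ x, χ x * ψ x := by
  symm
  refine Finset.sum_bij (fun a _ => X - Polynomial.C a) ?_ ?_ ?_ ?_
  · intro a _
    exact mem_monics.2 ⟨monic_X_sub_C a, natDegree_X_sub_C a⟩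
  · intro a _ b _ h
    simpa using h
  · intro f hf
    obtain ⟨h1, h2⟩ := mem_monics.1 hf
    refine ⟨-f.coeff 0, mem_univ _, ?_⟩
    rw [map_neg, sub_neg_eq_add]
    exact (h1.eq_X_add_C h2).symm
  · intro a _
    simp [polyChar, nextCoeff_X_sub_C]

/-- Shifting the coefficient of `X^(m-1)` permutes the monic polynomials of degree `m` and
multiplies `polyChar` by a value of `ψ` other than `1`. The constant term is untouched because `m ≥
2`. -/
theorem sum_monics_eq_zero (hψ : ψ ≠ 1) {m : ℕ} (hm : 2 ≤ m) :
    ∑ f ∈ monics K m, polyChar χ ψ f = 0 := by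
  obtain ⟨b, hb⟩ : ∃ b, ψ b ≠ 1 := by
    by_contra! h
    exact hψ (by ext b; simp [h])
  have key : ∀ c : K, ∀ f ∈ monics K m, f + Polynomial.C c * X ^ (m - 1) ∈ monics K m := by
    intro c f hf
    obtain ⟨h1, h2⟩ := mem_monics.1 hf
    have hlt : (Polynomial.C c * X ^ (m - 1)).degree < f.degree := by
      refine (degree_C_mul_X_pow_le _ _).trans_lt ?_
      rw [degree_eq_natDegree h1.ne_zero, h2]
      exact_mod_cast (by omega : m - 1 < m)
    refine mem_monics.2 ⟨h1.add_of_left hlt, ?_⟩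
    rw [natDegree_add_eq_left_of_degree_lt hlt, h2]
  have hval : ∀ f ∈ monics K m, polyChar χ ψ (f + Polynomial.C (-b) * X ^ (m - 1)) =
      ψ b * polyChar χ ψ f := by
    intro f hf
    obtain ⟨-, h2⟩ := mem_monics.1 hf
    obtain ⟨-, h4⟩ := mem_monics.1 (key (-b) f hf)
    rw [polyChar, polyChar, h4, h2, nextCoeff_of_natDegree_pos (by omega),
      nextCoeff_of_natDegree_pos (by omega), h4, h2]
    simp only [coeff_add, coeff_C_mul, coeff_X_pow]
    rw [if_neg (by omega), if_pos trivial, mul_zero, add_zero, mul_one, neg_add, neg_neg,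
      AddChar.map_add_eq_mul]
    ring
  have hsum : ∑ f ∈ monics K m, polyChar χ ψ f = ψ b * ∑ f ∈ monics K m, polyChar χ ψ f := by
    conv_rhs => rw [Finset.mul_sum]
    symm
    refine Finset.sum_bij' (fun f _ => f + Polynomial.C (-b) * X ^ (m - 1))
      (fun f _ => f + Polynomial.C b * X ^ (m - 1)) (key _) (key _) ?_ ?_ ?_
    · intro f _
      simp
    · intro f _
      simp
    · intro f hf
      exact (hval f hf).symm
  have : (1 - ψ b) * ∑ f ∈ monics K m, polyChar χ ψ f = 0 := by
    rw [sub_mul, one_mul, ← hsum, sub_self]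
  exact (mul_eq_zero.1 this).resolve_left (sub_ne_zero.2 hb.symm)

-- The polynomial analogue of `log = Λ * 1`: an irreducible `P` of multiplicity `e` in `f` is
-- counted once for each `j ≤ e`.
open Classical in
theorem natDegree_eq_sum_irreducible_pow {m : ℕ} {f : K[X]} (hf : f ∈ monics K m) :
    m = ∑ P ∈ monicIrreducibles K m, ∑ j ∈ Finset.Icc 1 m,
      if P ^ j ∣ f then P.natDegree else 0 := by
  obtain ⟨h1, h2⟩ := mem_monics.1 hf
  set s := UniqueFactorizationMonoid.normalizedFactors f with hs
  have hprod : s.prod = f := by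
    have := leadingCoeff_mul_prod_normalizedFactors f
    rwa [h1.leadingCoeff, map_one, one_mul] at this
  have hmem : ∀ P ∈ s, P.Monic ∧ Irreducible P ∧ P ∣ f := by
    intro P hP
    have hirr := UniqueFactorizationMonoid.irreducible_of_normalized_factor P hP
    refine ⟨?_, hirr, UniqueFactorizationMonoid.dvd_of_mem_normalizedFactors hP⟩
    rw [← UniqueFactorizationMonoid.normalize_normalized_factor P hP]
    exact monic_normalize hirr.ne_zero
  have hdeg : m = (s.map natDegree).sum := by
    rw [← h2, ← natDegree_multiset_prod_of_monic _ fun P hP => (hmem P hP).1, hprod]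
  have hsub : s.toFinset ⊆ monicIrreducibles K m := by
    intro P hP
    obtain ⟨hP1, hP2, hP3⟩ := hmem P (Multiset.mem_toFinset.1 hP)
    exact mem_monicIrreducibles.2 ⟨hP1, hP2, h2 ▸ natDegree_le_of_dvd hP3 h1.ne_zero⟩
  conv_lhs => rw [hdeg]
  rw [Finset.sum_multiset_map_count, Finset.sum_subset hsub]
  · refine Finset.sum_congr rfl fun P hP => ?_
    obtain ⟨hP1, hP2, hP3⟩ := mem_monicIrreducibles.1 hP
    have hdvd : ∀ j, P ^ j ∣ f ↔ j ≤ s.count P := by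
      intro j
      rw [pow_dvd_iff_le_emultiplicity,
        UniqueFactorizationMonoid.emultiplicity_eq_count_normalizedFactors hP2 h1.ne_zero,
        hP1.normalize_eq_self, Nat.cast_le]
    have hcount : s.count P ≤ m := by
      have h := natDegree_le_of_dvd ((hdvd (s.count P)).2 le_rfl) h1.ne_zero
      rw [hP1.natDegree_pow, h2] at h
      exact (Nat.le_mul_of_pos_right _ hP2.natDegree_pos).trans h
    rw [← Finset.sum_filter, Finset.sum_const]
    congr 1
    have : (Finset.Icc 1 m).filter (fun j => P ^ j ∣ f) = Finset.Icc 1 (s.count P) := by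
      ext j
      simp only [mem_filter, mem_Icc, hdvd]
      omega
    rw [this]
    simp
  · intro P _ hP
    rw [Multiset.count_eq_zero_of_notMem (by simpa using hP), zero_smul]

open Classical in
theorem sum_monics_dvd {m : ℕ} {Q : K[X]} (hQ : Q.Monic) :
    ∑ f ∈ monics K m with Q ∣ f, polyChar χ ψ f =
      if Q.natDegree ≤ m then polyChar χ ψ Q * ∑ g ∈ monics K (m - Q.natDegree), polyChar χ ψ g
      else 0 := by
  split_ifs with h
  · rw [Finset.mul_sum]
    symm
    refine Finset.sum_bij (fun g _ => Q * g) ?_ ?_ ?_ ?_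
    · intro g hg
      obtain ⟨h1, h2⟩ := mem_monics.1 hg
      refine mem_filter.2 ⟨mem_monics.2 ⟨hQ.mul h1, ?_⟩, dvd_mul_right _ _⟩
      rw [hQ.natDegree_mul h1, h2]
      omega
    · intro g _ g' _ hgg
      exact mul_left_cancel₀ hQ.ne_zero hgg
    · intro f hf
      obtain ⟨hf, g, rfl⟩ := mem_filter.1 hf
      obtain ⟨h1, h2⟩ := mem_monics.1 hf
      have hg := hQ.of_mul_monic_left h1
      refine ⟨g, mem_monics.2 ⟨hg, ?_⟩, rfl⟩
      rw [hQ.natDegree_mul hg] at h2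
      omega
    · intro g hg
      rw [polyChar_mul χ ψ hQ (mem_monics.1 hg).1]
  · rw [Finset.filter_false_of_mem, Finset.sum_empty]
    intro f hf hdvd
    obtain ⟨h1, h2⟩ := mem_monics.1 hf
    exact h (h2 ▸ natDegree_le_of_dvd hdvd h1.ne_zero)

/-- The sum of `deg P * λ(P ^ j)` over the prime powers `P ^ j` of degree `i`, where `λ` is the
multiplicative function `polyChar χ ψ`. -/
def primePowerSum (i : ℕ) : C :=
  ∑ P ∈ monicIrreducibles K i with P.natDegree ∣ i,
    (P.natDegree : C) * polyChar χ ψ P ^ (i / P.natDegree)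

/-- This is the logarithmic derivative of the Euler product for `∑ S_m t^m`, read coefficient by
coefficient. Summing the von Mangoldt identity against `polyChar` avoids infinite products. -/
theorem natDegree_mul_sum_monics (m : ℕ) :
    (m : C) * ∑ f ∈ monics K m, polyChar χ ψ f =
      ∑ i ∈ Finset.Icc 1 m, primePowerSum χ ψ i * ∑ f ∈ monics K (m - i), polyChar χ ψ f := by
  classical
  set S : ℕ → C := fun i => ∑ f ∈ monics K i, polyChar χ ψ f with hS
  have h1 : (m : C) * S m = ∑ P ∈ monicIrreducibles K m, ∑ j ∈ Finset.Icc 1 m,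
      if j * P.natDegree ≤ m then
        (P.natDegree : C) * (polyChar χ ψ P ^ j * S (m - j * P.natDegree)) else 0 := by
    calc (m : C) * S m = ∑ f ∈ monics K m, ∑ P ∈ monicIrreducibles K m, ∑ j ∈ Finset.Icc 1 m,
          if P ^ j ∣ f then (P.natDegree : C) * polyChar χ ψ f else 0 := by
          rw [hS, Finset.mul_sum]
          refine Finset.sum_congr rfl fun f hf => ?_
          conv_lhs => rw [natDegree_eq_sum_irreducible_pow hf]
          push_cast
          rw [Finset.sum_mul]
          refine Finset.sum_congr rfl fun P _ => ?_
          rw [Finset.sum_mul]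
          refine Finset.sum_congr rfl fun j _ => ?_
          split_ifs <;> simp
      _ = ∑ P ∈ monicIrreducibles K m, ∑ j ∈ Finset.Icc 1 m, ∑ f ∈ monics K m,
          if P ^ j ∣ f then (P.natDegree : C) * polyChar χ ψ f else 0 := by
          rw [Finset.sum_comm]
          refine Finset.sum_congr rfl fun P _ => ?_
          rw [Finset.sum_comm]
      _ = _ := by
          refine Finset.sum_congr rfl fun P hP => Finset.sum_congr rfl fun j _ => ?_
          have hPm := (mem_monicIrreducibles.1 hP).1
          rw [← Finset.sum_filter, ← Finset.mul_sum, sum_monics_dvd χ ψ (hPm.pow j),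
            hPm.natDegree_pow, polyChar_pow χ ψ hPm]
          split_ifs <;> simp [hS]
  have h2 : ∀ i ∈ Finset.Icc 1 m, primePowerSum χ ψ i * S (m - i) =
      ∑ P ∈ monicIrreducibles K m, if P.natDegree ∣ i then
        (P.natDegree : C) * (polyChar χ ψ P ^ (i / P.natDegree) * S (m - i)) else 0 := by
    intro i hi
    rw [mem_Icc] at hi
    rw [primePowerSum, Finset.sum_mul, ← Finset.sum_filter]
    refine Finset.sum_congr ?_ fun P _ => by rw [mul_assoc]
    ext P
    simp only [mem_filter, mem_monicIrreducibles]
    constructor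
    · rintro ⟨⟨h1, h2, h3⟩, h4⟩
      exact ⟨⟨h1, h2, h3.trans hi.2⟩, h4⟩
    · rintro ⟨⟨h1, h2, h3⟩, h4⟩
      exact ⟨⟨h1, h2, Nat.le_of_dvd hi.1 h4⟩, h4⟩
  rw [h1, Finset.sum_congr rfl h2]
  conv_rhs => rw [Finset.sum_comm]
  refine Finset.sum_congr rfl fun P hP => ?_
  have hpos := (mem_monicIrreducibles.1 hP).2.1.natDegree_pos
  rw [← Finset.sum_filter, ← Finset.sum_filter]
  refine Finset.sum_bij (fun j _ => j * P.natDegree) ?_ ?_ ?_ ?_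
  · intro j hj
    rw [mem_filter, mem_Icc] at hj ⊢
    exact ⟨⟨Nat.mul_pos hj.1.1 hpos, hj.2⟩, dvd_mul_left _ _⟩
  · intro j _ j' _ h
    exact Nat.eq_of_mul_eq_mul_right hpos h
  · intro i hi
    rw [mem_filter, mem_Icc] at hi
    obtain ⟨⟨h1, h2⟩, j, rfl⟩ := hi
    refine ⟨j, ?_, mul_comm _ _⟩
    rw [mem_filter, mem_Icc]
    refine ⟨⟨Nat.pos_of_mul_pos_left h1, ?_⟩, by rwa [mul_comm]⟩
    exact (Nat.le_mul_of_pos_left _ hpos).trans h2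
  · intro j _
    rw [Nat.mul_div_cancel _ hpos]

/-- The generating series is `1 + g t` with `g` the Gauss sum, so its logarithmic derivative is
geometric. In the recurrence only the top two terms survive. -/
theorem primePowerSum_succ [Fintype K] (hψ : ψ ≠ 1) (m : ℕ) :
    primePowerSum χ ψ (m + 1) = (-1) ^ m * (∑ x, χ x * ψ x) ^ (m + 1) := by
  induction m with
  | zero =>
    have := natDegree_mul_sum_monics χ ψ 1
    rw [sum_monics_one] at this
    simp only [Finset.Icc_self, sum_singleton, Nat.sub_self, sum_monics_zero] at this
    simpa using this.symm
  | succ m ih =>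
    have := natDegree_mul_sum_monics χ ψ (m + 2)
    rw [sum_monics_eq_zero χ ψ hψ (by omega), mul_zero, Finset.sum_Icc_succ_top (by omega),
      Finset.sum_Icc_succ_top (by omega), Finset.sum_eq_zero, Nat.sub_self, sum_monics_zero,
      show m + 2 - (m + 1) = 1 by omega, sum_monics_one, ih] at this
    · rw [zero_add, mul_one] at this
      rw [← sub_eq_zero, this]
      ring
    · intro i hi
      rw [mem_Icc] at hi
      rw [sum_monics_eq_zero χ ψ hψ (by omega), mul_zero]

section Extension

variable {E : Type*} [Field E] [Algebra K E] [Finite E]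

-- When its degree divides `[E : K]`, `P` divides `X^|E| - X`, hence splits in `E`, and it is
-- separable because finite fields are perfect.
open Classical in
theorem card_minpoly_eq [Fintype E] {P : K[X]} (hP : P.Monic) (hirr : Irreducible P)
    (hdvd : P.natDegree ∣ Module.finrank K E) :
    (univ.filter fun x : E => minpoly K x = P).card = P.natDegree := by
  have : FiniteDimensional K E := Module.Finite.of_finite
  have h1 := hirr.natDegree_dvd_iff_dvd_X_pow_card_pow_sub_X.1 hdvd
  have hsplit : (P.map (algebraMap K E)).Splits := by
    have h2 : IsSplittingField K E (X ^ Nat.card K ^ Module.finrank K E - X) := by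
      rw [← Module.natCard_eq_pow_finrank, Nat.card_eq_fintype_card]
      exact FiniteField.isSplittingField_sub E K
    refine Splits.of_dvd h2.splits' ?_ (Polynomial.map_dvd _ h1)
    exact map_ne_zero (FiniteField.X_pow_card_pow_sub_X_ne_zero _ Module.finrank_pos.ne'
      Finite.one_lt_card)
  have hsep : P.Separable := PerfectField.separable_of_irreducible hirr
  rw [← card_rootSet_eq_natDegree hsep hsplit, ← Set.toFinset_card]
  congr 1
  ext x
  rw [mem_filter, Set.mem_toFinset, mem_rootSet]
  constructor
  · rintro ⟨-, rfl⟩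
    exact ⟨hP.ne_zero, minpoly.aeval K x⟩
  · rintro ⟨-, h⟩
    exact ⟨mem_univ _, (minpoly.eq_of_irreducible_of_monic hirr h hP).symm⟩

omit [Finite K] in
theorem mulChar_norm_mul_addChar_trace (x : E) :
    χ (Algebra.norm K x) * ψ (Algebra.trace K E x) =
      polyChar χ ψ (minpoly K x) ^ (Module.finrank K E / (minpoly K x).natDegree) := by
  have : FiniteDimensional K E := Module.Finite.of_finite
  have hx : IsIntegral K x := .of_finite K x
  have hr : Module.finrank K E / (minpoly K x).natDegree =
      Module.finrank (IntermediateField.adjoin K {x}) E := by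
    rw [← IntermediateField.adjoin.finrank hx,
      ← Module.finrank_mul_finrank K (IntermediateField.adjoin K {x}) E,
      Nat.mul_div_cancel_left _ Module.finrank_pos]
  have hn := Algebra.PowerBasis.norm_gen_eq_coeff_zero_minpoly
    (IntermediateField.adjoin.powerBasis hx)
  rw [IntermediateField.adjoin.powerBasis_gen hx, IntermediateField.minpoly_gen,
    IntermediateField.adjoin.powerBasis_dim] at hn
  rw [hr, polyChar, mul_pow, ← map_pow, Algebra.norm_eq_norm_adjoin, hn,
    trace_eq_finrank_mul_minpoly_nextCoeff, ← AddChar.map_nsmul_eq_pow, nsmul_eq_mul]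

/-- Grouping the elements of `E` by minimal polynomial yields the prime powers of degree `[E : K]`,
each weighted by `deg P`. -/
theorem sum_mulChar_norm_mul_addChar_trace [Fintype E] :
    ∑ x : E, χ (Algebra.norm K x) * ψ (Algebra.trace K E x) =
      primePowerSum χ ψ (Module.finrank K E) := by
  classical
  have : FiniteDimensional K E := Module.Finite.of_finite
  simp only [mulChar_norm_mul_addChar_trace]
  rw [primePowerSum]
  rw [← Finset.sum_fiberwise_of_maps_to (g := minpoly K)
    (t := (monicIrreducibles K (Module.finrank K E)).filter
      fun P => P.natDegree ∣ Module.finrank K E)]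
  · refine Finset.sum_congr rfl fun P hP => ?_
    rw [mem_filter, mem_monicIrreducibles] at hP
    rw [Finset.sum_congr rfl (g := fun _ => polyChar χ ψ P ^ (Module.finrank K E / P.natDegree))]
    · rw [Finset.sum_const, card_minpoly_eq hP.1.1 hP.1.2.1 hP.2, nsmul_eq_mul]
    · intro x hx
      rw [(mem_filter.1 hx).2]
  · intro x _
    have hx : IsIntegral K x := .of_finite K x
    have hdvd : (minpoly K x).natDegree ∣ Module.finrank K E := by
      rw [← IntermediateField.adjoin.finrank hx]
      exact Dvd.intro _ (Module.finrank_mul_finrank K _ E)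
    exact mem_filter.2 ⟨mem_monicIrreducibles.2 ⟨minpoly.monic hx, minpoly.irreducible hx,
      Nat.le_of_dvd Module.finrank_pos hdvd⟩, hdvd⟩

/-- The Hasse–Davenport relation. -/
theorem hasse_davenport [Fintype K] [Fintype E] (hψ : ψ ≠ 1) :
    -∑ x : E, χ (Algebra.norm K x) * ψ (Algebra.trace K E x) =
      (-∑ x, χ x * ψ x) ^ Module.finrank K E := by
  have : FiniteDimensional K E := Module.Finite.of_finite
  obtain ⟨m, hm⟩ := Nat.exists_eq_succ_of_ne_zero (Module.finrank_pos (R := K) (M := E)).ne'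
  rw [sum_mulChar_norm_mul_addChar_trace, hm, Nat.succ_eq_add_one, primePowerSum_succ χ ψ hψ,
    neg_pow (∑ x, χ x * ψ x)]
  ring

end Extension

end HasseDavenport

/-! ### The Teichmüller character and Stickelberger's theorem for prime fields -/

section Stickelberger

variable (p : ℕ) [Fact p.Prime]

/-- The inclusion of the `p`-adic integers into `PadicAlgCl p`. -/
def padicIntHom : ℤ_[p] →+* PadicAlgCl p :=
  (algebraMap ℚ_[p] (PadicAlgCl p)).comp PadicInt.Coe.ringHom

theorem norm_padicIntHom (z : ℤ_[p]) : ‖padicIntHom p z‖ = ‖z‖ :=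
  PadicAlgCl.norm_extends p (z : ℚ_[p])

theorem padicIntHom_injective : Function.Injective (padicIntHom p) :=
  (algebraMap ℚ_[p] (PadicAlgCl p)).injective.comp Subtype.val_injective

/-- The Teichmüller lift from `ZMod p` to the `p`-adic integers. -/
def teichInt : ZMod p →* ℤ_[p] :=
  ((WittVector.equiv p).toRingHom : WittVector p (ZMod p) →* ℤ_[p]).comp
    (WittVector.teichmuller p)

theorem teichInt_zero : teichInt p 0 = 0 := by
  simp [teichInt]

theorem toZMod_teichInt (x : ZMod p) : PadicInt.toZMod (teichInt p x) = x := by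
  have h : PadicInt.toZMod (teichInt p x - (x.val : ℤ_[p])) = 0 := by
    rw [← RingHom.mem_ker, PadicInt.ker_toZMod, IsLocalRing.mem_maximalIdeal, mem_nonunits_iff]
    intro hu
    -- Non-unitness is tested in Witt vectors, where the constant coefficient of a Teichmüller lift
    -- is the element itself.
    have h1 : teichInt p x - (x.val : ℤ_[p]) =
        WittVector.equiv p (WittVector.teichmuller p x - (x.val : WittVector p (ZMod p))) := by
      rw [map_sub, map_natCast]
      rfl
    rw [h1, MulEquiv.isUnit_map] at hu
    have h2 := hu.map (WittVector.constantCoeff : WittVector p (ZMod p) →+* ZMod p)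
    rw [map_sub, map_natCast, ZMod.natCast_zmod_val] at h2
    have h3 : WittVector.constantCoeff (WittVector.teichmuller p x) = x :=
      WittVector.teichmuller_coeff_zero p x
    rw [h3, sub_self] at h2
    exact not_isUnit_zero h2
  rw [map_sub, map_natCast, ZMod.natCast_zmod_val, sub_eq_zero] at h
  exact h

theorem norm_teichInt_sub_le (x : ZMod p) : ‖teichInt p x - (x.val : ℤ_[p])‖ ≤ (p : ℝ)⁻¹ := by
  have h : (p : ℤ_[p]) ∣ teichInt p x - (x.val : ℤ_[p]) := by
    rw [← Ideal.mem_span_singleton, ← PadicInt.maximalIdeal_eq_span_p, ← PadicInt.ker_toZMod,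
      RingHom.mem_ker, map_sub, map_natCast, ZMod.natCast_zmod_val, toZMod_teichInt, sub_self]
  obtain ⟨y, hy⟩ := h
  rw [hy, norm_mul, PadicInt.norm_p]
  exact mul_le_of_le_one_right (by positivity) (PadicInt.norm_le_one y)

/-- The Teichmüller character of `ZMod p` with values in `PadicAlgCl p`. -/
def teichChar : MulChar (ZMod p) (PadicAlgCl p) :=
  MulChar.ofUnitHom (Units.map ((padicIntHom p : ℤ_[p] →* PadicAlgCl p).comp (teichInt p)))

theorem teichChar_apply (x : ZMod p) : teichChar p x = padicIntHom p (teichInt p x) := by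
  by_cases hx : x = 0
  · rw [hx, MulChar.map_zero, teichInt_zero, map_zero]
  · obtain ⟨u, rfl⟩ := (Ne.isUnit hx)
    simp [teichChar]

theorem teichChar_pow_eq_one_iff (k : ℕ) : teichChar p ^ k = 1 ↔ p - 1 ∣ k := by
  have hcard := FiniteField.forall_pow_eq_one_iff (ZMod p) k
  rw [ZMod.card] at hcard
  rw [← hcard, MulChar.ext_iff]
  have hinj : Function.Injective fun x => padicIntHom p (teichInt p x) := fun x y h => by
    rw [← toZMod_teichInt p x, ← toZMod_teichInt p y, padicIntHom_injective p h]
  refine forall_congr' fun u => ?_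
  rw [MulChar.pow_apply_coe, MulChar.one_apply_coe, teichChar_apply, ← map_pow, ← map_pow]
  constructor
  · intro h
    ext
    rw [Units.val_pow_eq_pow_val]
    exact hinj (by simpa using h)
  · intro h
    rw [← Units.val_pow_eq_pow_val, h]
    simp

theorem norm_eq_one_of_pow_eq_one_of_ne_zero {K : Type*} [NormedDivisionRing K] {x : K} {k : ℕ}
    (h : x ^ k = 1) (hk : k ≠ 0) : ‖x‖ = 1 := by
  rw [← pow_eq_one_iff_of_nonneg (norm_nonneg x) hk, ← norm_pow, h, norm_one]

theorem norm_mulChar_le_one (χ : MulChar (ZMod p) (PadicAlgCl p)) (x : ZMod p) : ‖χ x‖ ≤ 1 := by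
  by_cases hx : x = 0
  · rw [hx, MulChar.map_zero, norm_zero]
    exact zero_le_one
  · have h : χ x ^ (p - 1) = 1 := by rw [← map_pow, ZMod.pow_card_sub_one_eq_one hx, map_one]
    exact (norm_eq_one_of_pow_eq_one_of_ne_zero h
      (Nat.sub_pos_of_lt (Fact.out : p.Prime).one_lt).ne').le

theorem norm_natCast_of_coprime {k : ℕ} (hk : ¬ p ∣ k) : ‖(k : PadicAlgCl p)‖ = 1 := by
  rw [← map_natCast (padicIntHom p), norm_padicIntHom]
  refine le_antisymm (PadicInt.norm_le_one _) (not_lt.1 fun h => hk ?_)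
  have := (PadicInt.norm_int_lt_one_iff_dvd (p := p) (k : ℤ)).1 (by simpa using h)
  exact_mod_cast this

variable {p} {ζ : PadicAlgCl p}

theorem norm_eq_one_of_isPrimitiveRoot (hζ : IsPrimitiveRoot ζ p) : ‖ζ‖ = 1 :=
  norm_eq_one_of_pow_eq_one_of_ne_zero hζ.pow_eq_one (Fact.out : p.Prime).ne_zero

theorem norm_one_sub_pow_le {a : PadicAlgCl p} (ha : ‖a‖ = 1) (k : ℕ) :
    ‖1 - a ^ k‖ ≤ ‖1 - a‖ := by
  rw [← mul_neg_geom_sum a k, norm_mul]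
  refine mul_le_of_le_one_right (norm_nonneg _) ?_
  refine IsUltrametricDist.norm_sum_le_of_forall_le_of_nonneg zero_le_one fun i _ => ?_
  rw [norm_pow, ha, one_pow]

/-- The product of `1 - μ` over the primitive roots is `Φ_p(1) = p`. Its `p - 1` factors have equal
norm, because any two primitive roots are powers of each other. -/
theorem norm_sub_one_pow (hζ : IsPrimitiveRoot ζ p) : ‖ζ - 1‖ ^ (p - 1) = (p : ℝ)⁻¹ := by
  have hp : p.Prime := Fact.out
  have h1 : ∏ μ ∈ primitiveRoots p (PadicAlgCl p), (1 - μ) = p := by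
    rw [← Polynomial.eval_one_cyclotomic_prime (R := PadicAlgCl p) (p := p),
      Polynomial.cyclotomic_eq_prod_X_sub_primitiveRoots hζ, Polynomial.eval_prod]
    simp
  have h2 : ∀ μ ∈ primitiveRoots p (PadicAlgCl p), ‖1 - μ‖ = ‖ζ - 1‖ := by
    intro μ hμ
    have hμ' := (mem_primitiveRoots hp.pos).1 hμ
    obtain ⟨i, -, hi⟩ := hζ.eq_pow_of_pow_eq_one hμ'.pow_eq_one
    obtain ⟨j, -, hj⟩ := hμ'.eq_pow_of_pow_eq_one hζ.pow_eq_one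
    rw [norm_sub_rev ζ]
    refine le_antisymm ?_ ?_
    · rw [← hi]
      exact norm_one_sub_pow_le (norm_eq_one_of_isPrimitiveRoot hζ) i
    · rw [← hj]
      exact norm_one_sub_pow_le (norm_eq_one_of_isPrimitiveRoot hμ') j
  have h3 := congrArg norm h1
  rw [norm_prod, Finset.prod_congr rfl h2, Finset.prod_const, hζ.card_primitiveRoots,
    Nat.totient_prime hp, ← map_natCast (padicIntHom p), norm_padicIntHom, PadicInt.norm_p] at h3
  exact h3

theorem sum_teichChar_inv_pow_mul_pow {i l : ℕ} (hi : i < p - 1) (hl : l ≤ i) :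
    ∑ x, ((teichChar p)⁻¹ ^ i) x * teichChar p x ^ l = if l = i then ((p - 1 : ℕ) : PadicAlgCl p)
      else 0 := by
  have hfun : ∀ x, ((teichChar p)⁻¹ ^ i) x * teichChar p x ^ l =
      ((teichChar p)⁻¹ ^ (i - l)) x := by
    intro x
    by_cases hx : x = 0
    · simp only [hx, MulChar.map_zero, zero_mul]
    · obtain ⟨u, rfl⟩ := Ne.isUnit hx
      rw [← MulChar.pow_apply_coe, ← MulChar.mul_apply]
      congr 1
      rw [show i = (i - l) + l by omega, pow_add, mul_assoc, ← mul_pow, inv_mul_cancel, one_pow,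
        mul_one, Nat.add_sub_cancel]
  simp only [hfun]
  split_ifs with h
  · rw [h, Nat.sub_self, pow_zero, MulChar.sum_one_eq_card_units, ZMod.card_units]
  · refine MulChar.sum_eq_zero_of_ne_one ?_
    rw [inv_pow, ne_eq, inv_eq_one, teichChar_pow_eq_one_iff]
    exact Nat.not_dvd_of_pos_of_lt (by omega) (by omega)

/-- Orthogonality of characters extracts the degree `i` coefficient. The bound on the degree rules
out a second exponent congruent to `i` modulo `p - 1`. -/
theorem sum_teichChar_inv_pow_mul_eval {i : ℕ} (hi : i < p - 1) {f : Polynomial (PadicAlgCl p)}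
    (hf : f.natDegree ≤ i) :
    ∑ x, ((teichChar p)⁻¹ ^ i) x * f.eval (teichChar p x) =
      f.coeff i * ((p - 1 : ℕ) : PadicAlgCl p) := by
  have h : ∀ x, ((teichChar p)⁻¹ ^ i) x * f.eval (teichChar p x) =
      ∑ l ∈ range (i + 1), f.coeff l * (((teichChar p)⁻¹ ^ i) x * teichChar p x ^ l) := by
    intro x
    rw [Polynomial.eval_eq_sum_range' (Nat.lt_succ_of_le hf), Finset.mul_sum]
    exact Finset.sum_congr rfl fun l _ => by ring
  simp only [h]
  rw [Finset.sum_comm]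
  simp only [← Finset.mul_sum]
  rw [Finset.sum_eq_single i]
  · rw [sum_teichChar_inv_pow_mul_pow hi le_rfl, if_pos rfl]
  · intro l hl hne
    rw [mem_range] at hl
    rw [sum_teichChar_inv_pow_mul_pow hi (by omega), if_neg hne, mul_zero]
  · intro h
    exact absurd (mem_range.2 (Nat.lt_succ_self i)) h

theorem norm_eval_descPochhammer_le (j : ℕ) (x : ZMod p) :
    ‖(descPochhammer (PadicAlgCl p) j).eval (teichChar p x)‖ ≤ 1 := by
  rw [teichChar_apply, ← descPochhammer_map (padicIntHom p), Polynomial.eval_map_apply,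
    norm_padicIntHom]
  exact PadicInt.norm_le_one _

theorem norm_eval_descPochhammer_sub_le (j : ℕ) (x : ZMod p) :
    ‖(descPochhammer (PadicAlgCl p) j).eval (teichChar p x) - (x.val.descFactorial j : ℕ)‖ ≤
      (p : ℝ)⁻¹ := by
  obtain ⟨y, hy⟩ := Polynomial.sub_dvd_eval_sub (teichInt p x) (x.val : ℤ_[p])
    (descPochhammer ℤ_[p] j)
  rw [descPochhammer_eval_eq_descFactorial] at hy
  rw [teichChar_apply, ← descPochhammer_map (padicIntHom p), Polynomial.eval_map_apply,
    ← map_natCast (padicIntHom p), ← map_sub, norm_padicIntHom, hy, norm_mul]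
  exact (mul_le_of_le_one_right (norm_nonneg _) (PadicInt.norm_le_one y)).trans
    (norm_teichInt_sub_le p x)

theorem norm_factorial {j : ℕ} (hj : j < p) : ‖(j.factorial : PadicAlgCl p)‖ = 1 :=
  norm_natCast_of_coprime p fun h => hj.not_ge (((Fact.out : p.Prime).dvd_factorial).1 h)

/-- Binomial expansion of `(1 + (ζ - 1))^x`. Falling factorials replace binomial coefficients
because they are values of integral polynomials, which can also be evaluated at the Teichmüller
lift. -/
theorem zmodChar_eq_sum (hζ : ζ ^ p = 1) (x : ZMod p) :
    AddChar.zmodChar p hζ x =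
      ∑ j ∈ range p, (ζ - 1) ^ j / (j.factorial : PadicAlgCl p) *
        (x.val.descFactorial j : PadicAlgCl p) := by
  rw [AddChar.zmodChar_apply]
  have h : ζ ^ x.val = ∑ j ∈ range (x.val + 1), (ζ - 1) ^ j * (x.val.choose j : PadicAlgCl p) := by
    conv_lhs => rw [← sub_add_cancel ζ 1, add_pow]
    simp
  rw [h]
  have hsub : range (x.val + 1) ⊆ range p := by
    rw [range_subset_range]
    exact ZMod.val_lt x
  rw [Finset.sum_subset hsub]
  · refine Finset.sum_congr rfl fun j _ => ?_
    have : (j.factorial : PadicAlgCl p) ≠ 0 := by exact_mod_cast j.factorial_ne_zero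
    rw [Nat.descFactorial_eq_factorial_mul_choose]
    push_cast
    field_simp
  · intro j _ hj
    rw [mem_range, not_lt] at hj
    rw [Nat.choose_eq_zero_of_lt (by omega), Nat.cast_zero, mul_zero]

/-- Stickelberger's theorem over the prime field. -/
theorem norm_gauss_sum (hζ : IsPrimitiveRoot ζ p) {i : ℕ} (hi : i < p - 1) :
    ‖∑ x, ((teichChar p)⁻¹ ^ i) x * AddChar.zmodChar p hζ.pow_eq_one x‖ = ‖ζ - 1‖ ^ i := by
  have hp : p.Prime := Fact.out
  set π : PadicAlgCl p := ζ - 1 with hπ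
  set χ := (teichChar p)⁻¹ ^ i with hχ
  have hpow := norm_sub_one_pow hζ
  have hpinv : (p : ℝ)⁻¹ < 1 := inv_lt_one_of_one_lt₀ (by exact_mod_cast hp.one_lt)
  have hπ1 : ‖π‖ < 1 := by
    by_contra h
    have := one_le_pow₀ (not_lt.1 h) (n := p - 1)
    rw [hpow] at this
    exact absurd hpinv (not_lt.2 this)
  have hπ0 : 0 < ‖π‖ := by
    refine norm_pos_iff.2 fun h => ?_
    rw [← hπ, h, norm_zero, zero_pow (by omega)] at hpow
    exact (inv_pos.2 (by exact_mod_cast hp.pos : (0 : ℝ) < p)).ne hpow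
  -- As `i + 1 ≤ p - 1`, an error of size `p⁻¹` is negligible against a main term of size `‖π‖ ^ i`.
  have hpi : (p : ℝ)⁻¹ ≤ ‖π‖ ^ (i + 1) := by
    rw [← hpow]
    exact pow_le_pow_of_le_one hπ0.le hπ1.le (by omega)
  have hcoef : ∀ j ∈ range p, ‖π ^ j / (j.factorial : PadicAlgCl p)‖ = ‖π‖ ^ j := by
    intro j hj
    rw [norm_div, norm_factorial (mem_range.1 hj), div_one, norm_pow]
  -- The additive character with the residue `x.val` replaced by the Teichmüller value, to which it
  -- is congruent modulo `p`.
  set E : ZMod p → PadicAlgCl p := fun x => ∑ j ∈ range p, π ^ j / (j.factorial : PadicAlgCl p) *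
    (descPochhammer (PadicAlgCl p) j).eval (teichChar p x) with hE
  have herr : ‖∑ x, χ x * AddChar.zmodChar p hζ.pow_eq_one x - ∑ x, χ x * E x‖ ≤
      ‖π‖ ^ (i + 1) := by
    refine le_trans ?_ hpi
    rw [← Finset.sum_sub_distrib]
    refine IsUltrametricDist.norm_sum_le_of_forall_le_of_nonneg (by positivity) fun x _ => ?_
    rw [← mul_sub, norm_mul, zmodChar_eq_sum, hE, ← Finset.sum_sub_distrib]
    refine (mul_le_of_le_one_left (norm_nonneg _) (norm_mulChar_le_one p χ x)).trans ?_
    refine IsUltrametricDist.norm_sum_le_of_forall_le_of_nonneg (by positivity) fun j hj => ?_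
    rw [← mul_sub, norm_mul, norm_sub_rev, hcoef j hj]
    exact (mul_le_of_le_one_left (norm_nonneg _) (pow_le_one₀ hπ0.le hπ1.le)).trans
      (norm_eval_descPochhammer_sub_le j x)
  have hswap : ∑ x, χ x * E x = ∑ j ∈ range p, π ^ j / (j.factorial : PadicAlgCl p) *
      ∑ x, χ x * (descPochhammer (PadicAlgCl p) j).eval (teichChar p x) := by
    simp only [hE, Finset.mul_sum]
    rw [Finset.sum_comm]
    exact Finset.sum_congr rfl fun j _ => Finset.sum_congr rfl fun x _ => by ring
  have hi' : i ∈ range p := mem_range.2 (by omega)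
  -- The contribution of `j = i`. Terms with `j < i` vanish by orthogonality, and those with `j > i`
  -- carry a higher power of `π`.
  set A : PadicAlgCl p := π ^ i / (i.factorial : PadicAlgCl p) * ((p - 1 : ℕ) : PadicAlgCl p)
    with hA
  have hAnorm : ‖A‖ = ‖π‖ ^ i := by
    rw [hA, norm_mul, hcoef i hi', norm_natCast_of_coprime p, mul_one]
    exact Nat.not_dvd_of_pos_of_lt (by omega) (by omega)
  have hmain : ‖∑ x, χ x * E x - A‖ ≤ ‖π‖ ^ (i + 1) := by
    rw [hswap, ← Finset.add_sum_erase _ _ hi', sum_teichChar_inv_pow_mul_eval hi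
      (descPochhammer_natDegree _ _).le]
    have hc : (descPochhammer (PadicAlgCl p) i).coeff i = 1 := by
      have := (monic_descPochhammer (PadicAlgCl p) i).coeff_natDegree
      rwa [descPochhammer_natDegree] at this
    rw [hc, one_mul, ← hA, add_sub_cancel_left]
    refine IsUltrametricDist.norm_sum_le_of_forall_le_of_nonneg (by positivity) fun j hj => ?_
    rw [mem_erase] at hj
    rcases lt_or_gt_of_ne hj.1 with h | h
    · rw [sum_teichChar_inv_pow_mul_eval hi ((descPochhammer_natDegree _ _).le.trans h.le),
        Polynomial.coeff_eq_zero_of_natDegree_lt (by rwa [descPochhammer_natDegree]), zero_mul,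
        mul_zero, norm_zero]
      positivity
    · rw [norm_mul, hcoef j hj.2]
      refine (mul_le_of_le_one_right (by positivity) ?_).trans
        (pow_le_pow_of_le_one hπ0.le hπ1.le h)
      refine IsUltrametricDist.norm_sum_le_of_forall_le_of_nonneg zero_le_one fun x _ => ?_
      rw [norm_mul]
      exact mul_le_one₀ (norm_mulChar_le_one p χ x) (norm_nonneg _)
        (norm_eval_descPochhammer_le j x)
  have htot : ‖∑ x, χ x * AddChar.zmodChar p hζ.pow_eq_one x - A‖ < ‖A‖ := by
    rw [hAnorm, ← sub_add_sub_cancel _ (∑ x, χ x * E x)]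
    refine (IsUltrametricDist.norm_add_le_max _ _).trans_lt ?_
    refine (max_le herr hmain).trans_lt ?_
    exact pow_lt_pow_right_of_lt_one₀ hπ0 hπ1 (Nat.lt_succ_self i)
  rw [← hAnorm, ← sub_add_cancel (∑ x, χ x * AddChar.zmodChar p hζ.pow_eq_one x) A,
    IsUltrametricDist.norm_add_eq_max_of_norm_ne_norm htot.ne, max_eq_right htot.le]

end Stickelberger

/-! ### Exponentials of logarithmic power series -/

section PowerSeriesExp

open PowerSeries

variable {K R : Type*} [Field K] [Fintype R]

/-- The geometric series `∑ c^(k+1) X^k`, the logarithmic derivative of `(1 - c X)⁻¹`. -/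
def geomSeries (c : K) : PowerSeries K := mk fun k => c ^ (k + 1)

theorem geomSeries_mul (c : K) : geomSeries c * (1 - C c * X) = C c := by
  ext k
  rw [mul_sub, mul_one, ← mul_assoc, mul_comm (geomSeries c), map_sub, mul_assoc, coeff_C_mul]
  cases k with
  | zero => simp [geomSeries]
  | succ k => simp [geomSeries, coeff_succ_mul_X, pow_succ']

theorem derivative_prod_one_sub (c : R → K) :
    derivative K (∏ r, (1 - C (c r) * X)) =
      -(∑ r, geomSeries (c r)) * ∏ r, (1 - C (c r) * X) := by
  classical
  suffices h : ∀ T : Finset R, derivative K (∏ r ∈ T, (1 - C (c r) * X)) =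
      -(∑ r ∈ T, geomSeries (c r)) * ∏ r ∈ T, (1 - C (c r) * X) from h univ
  intro T
  induction T using Finset.induction_on with
  | empty => simp
  | insert a T ha ih =>
    rw [Finset.prod_insert ha, Finset.sum_insert ha, Derivation.leibniz, ih, map_sub,
      Derivation.leibniz]
    simp only [smul_eq_mul, derivative_X, derivative_C, derivative_one]
    have := geomSeries_mul (c a)
    linear_combination (∏ r ∈ T, (1 - C (c r) * X)) * this

theorem exp_subst_of_derivative {L : PowerSeries K} [Algebra ℚ K] (hL : constantCoeff L = 0) :
    derivative K ((exp K).subst L) = (exp K).subst L * derivative K L ∧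
      constantCoeff ((exp K).subst L) = 1 := by
  have hs := HasSubst.of_constantCoeff_zero' hL
  constructor
  · rw [derivative_subst hs, derivative_exp]
  · have h : (exp K).subst L = (exp K - 1).subst L + 1 := by
      rw [subst_sub hs, ← coe_substAlgHom hs, map_one, sub_add_cancel]
    rw [h, map_add, map_one]
    have := constantCoeff_subst_eq_zero (R := K) (S := K) (a := L) hL (exp K - 1) (by simp)
    rw [show constantCoeff ((exp K - 1).subst L) = 0 from this, zero_add]

theorem constantCoeff_prod_one_sub (c : R → K) :
    constantCoeff (∏ r, (1 - C (c r) * X)) = 1 := by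
  rw [map_prod]
  simp

/-- Both sides have constant term `1` and the same logarithmic derivative, so in characteristic zero
their quotient is `1`. -/
theorem exp_subst_eq_prod [CharZero K] [Algebra ℚ K] {L : PowerSeries K} (hL : constantCoeff L = 0)
    (c : R → K) (hd : derivative K L = -∑ r, geomSeries (c r)) :
    (exp K).subst L = ∏ r, (1 - C (c r) * X) := by
  obtain ⟨h1, h2⟩ := exp_subst_of_derivative hL
  set P := ∏ r, (1 - C (c r) * X) with hP
  have hP0 : constantCoeff P = 1 := constantCoeff_prod_one_sub c
  have hinv : P * P⁻¹ = 1 := PowerSeries.mul_inv_cancel _ (by rw [hP0]; exact one_ne_zero)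
  have h : (exp K).subst L * P⁻¹ = 1 := by
    refine derivative.ext ?_ ?_
    · rw [Derivation.leibniz, derivative_inv', h1, hP, derivative_prod_one_sub, ← hP, hd,
        derivative_one]
      simp only [smul_eq_mul]
      linear_combination ((exp K).subst L * P⁻¹ * ∑ r, geomSeries (c r)) * hinv
    · rw [map_mul, h2, constantCoeff_inv, hP0]
      simp
  linear_combination P * h - (exp K).subst L * hinv

theorem exp_subst_inv_eq_prod [CharZero K] [Algebra ℚ K] {L : PowerSeries K} (hL : constantCoeff L = 0)
    (c : R → K) (hd : derivative K L = ∑ r, geomSeries (c r)) :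
    ((exp K).subst L)⁻¹ = ∏ r, (1 - C (c r) * X) := by
  obtain ⟨h1, h2⟩ := exp_subst_of_derivative hL
  have h : (exp K).subst L * ∏ r, (1 - C (c r) * X) = 1 := by
    refine derivative.ext ?_ ?_
    · rw [Derivation.leibniz, h1, derivative_prod_one_sub, hd, derivative_one]
      simp only [smul_eq_mul]
      ring
    · rw [map_mul, h2, constantCoeff_prod_one_sub, mul_one, map_one]
  rw [PowerSeries.inv_eq_iff_mul_eq_one (by rw [h2]; exact one_ne_zero), mul_comm, h]

end PowerSeriesExp

/-! ### From power sums of reciprocal zeros to the L-function -/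

section LFunction

variable {n : ℕ} (p : ℕ) [Fact p.Prime] {F : Type*} [Field F] [Finite F] [CharP F p]
  {R : Type*} [Fintype R]

theorem signedLFunction_eq_prod (ζ : PadicAlgCl p) (f : Laurent n F) (c : R → PadicAlgCl p)
    (h : ∀ (k : ℕ) [NeZero k], expSum p ζ f k = (-1) ^ n * ∑ r, c r ^ k) :
    signedLFunction p ζ f = ∏ r, (1 - PowerSeries.C (c r) * PowerSeries.X) := by
  have hd : PowerSeries.derivative _ (logLFunction p ζ f) = (-1) ^ n * ∑ r, geomSeries (c r) := by
    ext k
    have h1 : (-1 : PowerSeries (PadicAlgCl p)) ^ n = PowerSeries.C ((-1) ^ n) := by simp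
    rw [PowerSeries.coeff_derivative, logLFunction, mul_comm PowerSeries.X,
      PowerSeries.coeff_succ_mul_X, PowerSeries.coeff_mk, h, h1, PowerSeries.coeff_C_mul, map_sum]
    have hk : ((k + 1 : ℕ) : PadicAlgCl p) ≠ 0 := by exact_mod_cast k.succ_ne_zero
    simp only [geomSeries, PowerSeries.coeff_mk]
    push_cast at hk ⊢
    field_simp
  have h0 : PowerSeries.constantCoeff (logLFunction p ζ f) = 0 := by simp [logLFunction]
  rw [signedLFunction, LFunction]
  split_ifs with hn
  · rw [hn.neg_one_pow, one_mul] at hd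
    exact exp_subst_inv_eq_prod h0 c hd
  · rw [(Nat.not_even_iff_odd.1 hn).neg_one_pow, neg_one_mul] at hd
    exact exp_subst_eq_prod h0 c hd

end LFunction

/-! ### Monomial maps of tori -/

section TorusPow

variable {n : ℕ} {G : Type*} [CommGroup G]

theorem zpow_finsetSum {ι : Type*} (g : G) (s : Finset ι) (f : ι → ℤ) :
    g ^ ∑ i ∈ s, f i = ∏ i ∈ s, g ^ f i := by
  classical
  induction s using Finset.induction_on with
  | empty => simp
  | insert a s ha ih => rw [Finset.sum_insert ha, Finset.prod_insert ha, zpow_add, ih]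

/-- The monomial map attached to an integral matrix: the `j`-th coordinate of the image of `x` is
the monomial in `x` whose exponent is the `j`-th column. -/
def torusPow (A : Matrix (Fin n) (Fin n) ℤ) (x : Fin n → G) : Fin n → G :=
  fun j => ∏ i, x i ^ A i j

theorem torusPow_mul (A B : Matrix (Fin n) (Fin n) ℤ) (x : Fin n → G) :
    torusPow (A * B) x = torusPow B (torusPow A x) := by
  ext j
  simp only [torusPow, Matrix.mul_apply, ← Finset.prod_zpow, ← zpow_mul]
  rw [Finset.prod_comm]
  exact Finset.prod_congr rfl fun i _ => zpow_finsetSum _ _ _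

theorem torusPow_diagonal (d : Fin n → ℕ) (x : Fin n → G) :
    torusPow (Matrix.diagonal fun i => (d i : ℤ)) x = fun i => x i ^ d i := by
  ext j
  rw [torusPow, Finset.prod_eq_single j]
  · rw [Matrix.diagonal_apply_eq, zpow_natCast]
  · intro i _ hij
    rw [Matrix.diagonal_apply_ne _ hij, zpow_zero]
  · intro h
    exact absurd (mem_univ j) h

theorem torusPow_one (x : Fin n → G) : torusPow (1 : Matrix (Fin n) (Fin n) ℤ) x = x := by
  have := torusPow_diagonal (fun _ : Fin n => 1) x
  simpa using this

/-- The automorphism of the torus attached to a unimodular matrix. -/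
def torusEquiv (A : Matrix.GeneralLinearGroup (Fin n) ℤ) : (Fin n → G) ≃ (Fin n → G) where
  toFun := torusPow (A : Matrix (Fin n) (Fin n) ℤ)
  invFun := torusPow ((A⁻¹ : Matrix.GeneralLinearGroup (Fin n) ℤ) : Matrix (Fin n) (Fin n) ℤ)
  left_inv x := by rw [← torusPow_mul, Units.mul_inv, torusPow_one]
  right_inv x := by rw [← torusPow_mul, Units.inv_mul, torusPow_one]

/-- Since `P M = diag(d) Q⁻¹`, substituting `x = torusPow P z` splits the monomial map into
coordinatewise powers followed by an automorphism. The weight `N u i` is the number of `d i`-th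
roots of `u`. -/
theorem sum_torusPow [Fintype G] {C : Type*} [CommRing C] {M : Matrix (Fin n) (Fin n) ℤ}
    {d : Fin n → ℕ} {P Q : Matrix.GeneralLinearGroup (Fin n) ℤ}
    (h : (P : Matrix (Fin n) (Fin n) ℤ) * M * (Q : Matrix (Fin n) (Fin n) ℤ) =
        Matrix.diagonal fun i => (d i : ℤ))
    (N : G → Fin n → C) (hN : ∀ i (H : G → C), ∑ z, H (z ^ d i) = ∑ u, N u i * H u)
    (H : (Fin n → G) → C) :
    ∑ x, H (torusPow M x) =
      ∑ y, (∏ i, N (torusPow (Q : Matrix (Fin n) (Fin n) ℤ) y i) i) * H y := by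
  classical
  -- Testing `hN` on indicator functions identifies `N`.
  have hcard : ∀ i u, (((univ.filter fun z : G => z ^ d i = u).card : ℕ) : C) = N u i := by
    intro i u
    have := hN i (fun v => if v = u then 1 else 0)
    simpa [Finset.sum_ite_eq'] using this
  have hpow : ∀ H : (Fin n → G) → C, ∑ z : Fin n → G, H (fun i => z i ^ d i) =
      ∑ u : Fin n → G, (∏ i, N (u i) i) * H u := by
    intro H
    rw [← Finset.sum_fiberwise (s := univ) (fun (z : Fin n → G) i => z i ^ d i)]
    refine Finset.sum_congr rfl fun u _ => ?_
    rw [Finset.sum_congr rfl (g := fun _ => H u) fun z hz => by rw [(mem_filter.1 hz).2],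
      Finset.sum_const, nsmul_eq_mul]
    congr 1
    have : (univ.filter fun z : Fin n → G => (fun i => z i ^ d i) = u) =
        Fintype.piFinset fun i => univ.filter fun z : G => z ^ d i = u i := by
      ext z
      simp [funext_iff]
    rw [this, Fintype.card_piFinset, Nat.cast_prod]
    exact Finset.prod_congr rfl fun i _ => hcard i (u i)
  have hM : (P : Matrix (Fin n) (Fin n) ℤ) * M = (Matrix.diagonal fun i => (d i : ℤ)) *
      ((Q⁻¹ : Matrix.GeneralLinearGroup (Fin n) ℤ) : Matrix (Fin n) (Fin n) ℤ) := by
    rw [← h, mul_assoc, Units.mul_inv, mul_one]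
  rw [← Equiv.sum_comp (torusEquiv P) (fun x => H (torusPow M x))]
  have h1 : ∀ z : Fin n → G, H (torusPow M (torusEquiv P z)) =
      H ((torusEquiv Q).symm fun i => z i ^ d i) := by
    intro z
    rw [← torusPow_diagonal]
    change H (torusPow M (torusPow _ z)) = H (torusPow _ (torusPow _ z))
    rw [← torusPow_mul, hM, torusPow_mul]
  simp only [h1]
  rw [hpow fun u => H ((torusEquiv Q).symm u), ← Equiv.sum_comp (torusEquiv Q)]
  simp only [Equiv.symm_apply_apply]
  rfl

end TorusPow

/-- The fibre of `z ↦ z^d` over `u` has `d` elements or none. The geometric sum returns the same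
count, since the kernel of `χ` is the group of `d`-th powers. -/
theorem sum_comp_pow_of_isCyclic {G C : Type*} [CommGroup G] [IsCyclic G] [Fintype G] [Field C]
    {d : ℕ} (hd : d ∣ Fintype.card G) (χ : G →* C) (hχ : ∀ u, χ u = 1 ↔ ∃ z, z ^ d = u)
    (H : G → C) : ∑ z, H (z ^ d) = ∑ u, (∑ s ∈ range d, χ u ^ s) * H u := by
  classical
  rw [← Finset.sum_fiberwise (s := univ) (fun z : G => z ^ d)]
  refine Finset.sum_congr rfl fun u _ => ?_
  rw [Finset.sum_congr rfl (g := fun _ => H u) fun z hz => by rw [(mem_filter.1 hz).2],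
    Finset.sum_const, nsmul_eq_mul]
  congr 1
  by_cases hu : ∃ z, z ^ d = u
  · rw [(hχ u).2 hu]
    obtain ⟨z, rfl⟩ := hu
    have hk := IsCyclic.card_powMonoidHom_ker (G := G) d
    rw [Nat.card_eq_fintype_card (α := G), Nat.gcd_eq_right hd] at hk
    have : (univ.filter fun w : G => w ^ d = z ^ d).card = d := by
      conv_rhs => rw [← hk]
      rw [Nat.card_eq_fintype_card, Fintype.card_subtype]
      refine Finset.card_bij (fun w _ => w * z⁻¹) ?_ ?_ ?_
      · intro w hw
        simp [MonoidHom.mem_ker, mul_pow, (mem_filter.1 hw).2]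
      · intro w _ w' _ h
        exact mul_right_cancel h
      · intro w hw
        refine ⟨w * z, ?_, by simp⟩
        have hw' : w ^ d = 1 := by simpa [MonoidHom.mem_ker] using hw
        simp [mul_pow, hw']
    rw [this]
    simp
  · have h1 : χ u ≠ 1 := fun h => hu ((hχ u).1 h)
    have h2 : χ u ^ d = 1 := by rw [← map_pow]; exact (hχ _).2 ⟨u, rfl⟩
    have h3 : ∑ s ∈ range d, χ u ^ s = 0 := by
      have := geom_sum_mul (χ u) d
      rw [h2, sub_self] at this
      exact (mul_eq_zero.1 this).resolve_right (sub_ne_zero.2 h1)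
    rw [h3, Finset.filter_false_of_mem fun z _ hz => hu ⟨z, hz⟩]
    simp

/-! ### Evaluation on the torus -/

section TorusEval

variable {n : ℕ} {F : Type*} [Field F] {E : Type*} [Field E] [Algebra F E]

theorem torusEval_single (v : Fin n → ℤ) (c : F) (x : Fin n → Eˣ) :
    torusEval (AddMonoidAlgebra.single v c : Laurent n F) x =
      algebraMap F E c * ∏ i, ((x i ^ v i : Eˣ) : E) := by
  have h : ∀ f : Laurent n F, torusEval f x =
      f.coeff.sum fun v c => algebraMap F E c * ∏ i, ((x i ^ v i : Eˣ) : E) := fun _ => rfl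
  rw [h, AddMonoidAlgebra.coeff_single, Finsupp.sum_single_index]
  rw [map_zero, zero_mul]

/-- Evaluation at a point of the torus as an additive map. -/
def torusEvalHom (x : Fin n → Eˣ) : Laurent n F →+ E where
  toFun f := torusEval f x
  map_zero' := by simp [torusEval]
  map_add' f g := by
    have h : ∀ f : Laurent n F, torusEval f x =
      f.coeff.sum fun v c => algebraMap F E c * ∏ i, ((x i ^ v i : Eˣ) : E) := fun _ => rfl
    rw [h, h, h, AddMonoidAlgebra.coeff_add, Finsupp.sum_add_index']
    · simp
    · intro v c c'
      rw [map_add, add_mul]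

theorem torusEval_sum {ι : Type*} (s : Finset ι) (f : ι → Laurent n F) (x : Fin n → Eˣ) :
    torusEval (∑ i ∈ s, f i) x = ∑ i ∈ s, torusEval (f i) x :=
  map_sum (torusEvalHom x) f s

theorem torusEval_diagonal (M : Matrix (Fin n) (Fin n) ℤ) (a : Fin n → F) (x : Fin n → Eˣ) :
    torusEval (diagonal M a) x = ∑ j, algebraMap F E (a j) * ((torusPow M x j : Eˣ) : E) := by
  rw [diagonal, torusEval_sum]
  refine Finset.sum_congr rfl fun j _ => ?_
  rw [torusEval_single, torusPow, Units.coe_prod]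

end TorusEval

/-! ### Exponential sums of diagonal Laurent polynomials -/

section CharSums

variable (p : ℕ) [Fact p.Prime]

section Ext

variable (E : Type*) [Field E] [Algebra (ZMod p) E]

/-- The inverse Teichmüller character composed with the norm to the prime field. -/
def normChar : Eˣ →* (PadicAlgCl p)ˣ :=
  (teichChar p)⁻¹.toUnitHom.comp (Units.map (Algebra.norm (ZMod p)))

variable {E}

theorem normChar_apply (u : Eˣ) :
    (normChar p E u : PadicAlgCl p) = (teichChar p)⁻¹ (Algebra.norm (ZMod p) (u : E)) := by
  simp [normChar]

theorem teichChar_inv_pow_apply_unit (k : ℕ) (u : Eˣ) :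
    ((teichChar p)⁻¹ ^ k) (Algebra.norm (ZMod p) (u : E)) =
      (normChar p E u : PadicAlgCl p) ^ k := by
  rw [normChar_apply]
  exact MulChar.pow_apply_coe _ k (Units.map (Algebra.norm (ZMod p)) u)

theorem normChar_pow_card_sub_one (u : Eˣ) : normChar p E u ^ (p - 1) = 1 := by
  rw [normChar, MonoidHom.comp_apply, ← map_pow]
  have : (Units.map (Algebra.norm (ZMod p)) u) ^ (p - 1) = 1 := ZMod.units_pow_card_sub_one_eq_one p _
  rw [this, map_one]

theorem norm_pow_eq_one_of_normChar_pow {u : Eˣ} {k : ℕ} (h : normChar p E u ^ k = 1) :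
    Algebra.norm (ZMod p) (u : E) ^ k = 1 := by
  rw [normChar, MonoidHom.comp_apply, ← map_pow, ← Units.val_inj, MulChar.coe_toUnitHom,
    MulChar.inv_apply, teichChar_apply, Units.val_one] at h
  have h1 : padicIntHom p (teichInt p
      (Ring.inverse ((Units.map (Algebra.norm (ZMod p)) u ^ k : (ZMod p)ˣ) : ZMod p))) =
        padicIntHom p (teichInt p 1) := by
    rw [h, map_one, map_one]
  have h2 := congrArg PadicInt.toZMod (padicIntHom_injective p h1)
  rw [toZMod_teichInt, toZMod_teichInt, Ring.inverse_unit, Units.val_eq_one, inv_eq_one] at h2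
  simpa using congrArg Units.val h2

/-- This is where `d ∣ p - 1` matters: the `d`-th powers of every extension are detected by one
character of `F_p` composed with the norm. -/
theorem normChar_pow_eq_one_iff [Finite E] {d : ℕ} (hd : d ∣ p - 1) (u : Eˣ) :
    normChar p E u ^ ((p - 1) / d) = 1 ↔ ∃ z, z ^ d = u := by
  have hp1 : 0 < p - 1 := Nat.sub_pos_of_lt (Fact.out : p.Prime).one_lt
  obtain ⟨k, hk⟩ := hd
  have hd0 : 0 < d := Nat.pos_of_mul_pos_right (hk ▸ hp1)
  have hk0 : 0 < k := Nat.pos_of_mul_pos_left (hk ▸ hp1)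
  rw [hk, Nat.mul_div_cancel_left _ hd0]
  constructor
  · intro h
    have h1 := norm_pow_eq_one_of_normChar_pow p h
    have h2 := congrArg (algebraMap (ZMod p) E) h1
    -- The norm to `F_p` is the power map with exponent `(|E| - 1)/(p - 1)`, so the condition
    -- becomes one on the exponent of a generator.
    rw [map_pow, FiniteField.algebraMap_norm_eq_pow, Nat.card_zmod, map_one, ← pow_mul] at h2
    set N := Nat.card E - 1 with hN
    have hNc : Nat.card Eˣ = N := by rw [Nat.card_units]
    have hNpos : 0 < N := Nat.sub_pos_of_lt Finite.one_lt_card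
    have hdvd : p - 1 ∣ N := by
      rw [hN, Module.natCard_eq_pow_finrank (K := ZMod p), Nat.card_zmod]
      simpa using Nat.sub_dvd_pow_sub_pow p 1 (Module.finrank (ZMod p) E)
    obtain ⟨c, hc⟩ := hdvd
    rw [hc, Nat.mul_div_cancel_left _ hp1] at h2
    have hc0 : 0 < c := Nat.pos_of_mul_pos_left (hc ▸ hNpos)
    obtain ⟨g, hg⟩ := IsCyclic.exists_generator (α := Eˣ)
    obtain ⟨t, rfl⟩ : ∃ t : ℕ, g ^ t = u := by
      have := hg u
      rwa [← mem_powers_iff_mem_zpowers] at this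
    have h3 : g ^ (t * (c * k)) = 1 := by
      rw [pow_mul]
      exact Units.ext (by simpa using h2)
    have h4 : orderOf g = N := by
      rw [← hNc]
      exact orderOf_eq_card_of_forall_mem_zpowers hg
    have h5 := orderOf_dvd_of_pow_eq_one h3
    rw [h4, hc, hk, show d * k * c = d * (c * k) by ring] at h5
    obtain ⟨r, rfl⟩ := Nat.dvd_of_mul_dvd_mul_right (Nat.mul_pos hc0 hk0) h5
    exact ⟨g ^ r, by rw [← pow_mul, mul_comm]⟩
  · rintro ⟨z, rfl⟩
    rw [map_pow, ← pow_mul, ← hk, normChar_pow_card_sub_one]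

end Ext

variable {p} {n : ℕ} {d : Fin n → ℕ}

/-- The exponents of the multiplicative characters occurring in the exponential sum of a diagonal
Laurent polynomial. -/
def charExponent (p : ℕ) (Q : Matrix (Fin n) (Fin n) ℤ) (s : (i : Fin n) → Fin (d i))
    (j : Fin n) : ℕ :=
  ((∑ i, Q j i * (((p - 1) / d i * s i : ℕ) : ℤ)) % ((p - 1 : ℕ) : ℤ)).toNat

omit [Fact p.Prime] in
theorem charExponent_cast (hp : 1 < p) (Q : Matrix (Fin n) (Fin n) ℤ)
    (s : (i : Fin n) → Fin (d i)) (j : Fin n) : (charExponent p Q s j : ℤ) =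
      (∑ i, Q j i * (((p - 1) / d i * s i : ℕ) : ℤ)) % ((p - 1 : ℕ) : ℤ) :=
  Int.toNat_of_nonneg (Int.emod_nonneg _ (by omega))

omit [Fact p.Prime] in
theorem charExponent_lt (hp : 1 < p) (Q : Matrix (Fin n) (Fin n) ℤ)
    (s : (i : Fin n) → Fin (d i)) (j : Fin n) : charExponent p Q s j < p - 1 := by
  have h := Int.emod_lt_of_pos (∑ i, Q j i * (((p - 1) / d i * s i : ℕ) : ℤ))
    (show (0 : ℤ) < ((p - 1 : ℕ) : ℤ) by omega)
  rw [← charExponent_cast hp] at h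
  exact_mod_cast h

/-- Expanding the product attaches to each tuple `s` one power of `normChar` per coordinate `y j`.
Its exponent matters only modulo `p - 1`. -/
theorem prod_sum_normChar {E : Type*} [Field E] [Algebra (ZMod p) E]
    (Q : Matrix (Fin n) (Fin n) ℤ) (y : Fin n → Eˣ) :
    ∏ i, ∑ t ∈ range (d i), ((normChar p E (torusPow Q y i) ^ ((p - 1) / d i) :
      (PadicAlgCl p)ˣ) : PadicAlgCl p) ^ t =
      ∑ s : (i : Fin n) → Fin (d i), ∏ j,
        (normChar p E (y j) : PadicAlgCl p) ^ charExponent p Q s j := by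
  simp_rw [Finset.sum_range]
  rw [Finset.prod_univ_sum, Fintype.piFinset_univ]
  refine Finset.sum_congr rfl fun s _ => ?_
  norm_cast
  have h1 : ∀ i, (normChar p E (torusPow Q y i) ^ ((p - 1) / d i)) ^ (s i : ℕ) =
      ∏ j, normChar p E (y j) ^ (Q j i * (((p - 1) / d i * s i : ℕ) : ℤ)) := by
    intro i
    rw [torusPow, map_prod, ← pow_mul, ← Finset.prod_pow]
    refine Finset.prod_congr rfl fun j _ => ?_
    rw [map_zpow, zpow_mul, zpow_natCast]
  rw [Finset.prod_congr rfl fun i _ => h1 i, Finset.prod_comm]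
  refine Finset.prod_congr rfl fun j _ => ?_
  rw [← zpow_finsetSum, ← zpow_natCast, charExponent_cast (Fact.out : p.Prime).one_lt]
  exact zpow_eq_zpow_emod' _ (normChar_pow_card_sub_one p (y j))

theorem sum_torus_eq_sum_prod {E : Type*} [Field E] [Fintype E] [DecidableEq E]
    [Algebra (ZMod p) E]
    {M : Matrix (Fin n) (Fin n) ℤ} {P Q : Matrix.GeneralLinearGroup (Fin n) ℤ}
    (h : (P : Matrix (Fin n) (Fin n) ℤ) * M * (Q : Matrix (Fin n) (Fin n) ℤ) =
        Matrix.diagonal fun i => (d i : ℤ)) (hd : ∀ i, d i ∣ p - 1)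
    (g : Fin n → Eˣ → PadicAlgCl p) :
    ∑ x : Fin n → Eˣ, ∏ j, g j (torusPow M x j) =
      ∑ s : (i : Fin n) → Fin (d i), ∏ j, ∑ y : Eˣ, (normChar p E y : PadicAlgCl p) ^
        charExponent p (Q : Matrix (Fin n) (Fin n) ℤ) s j * g j y := by
  have hp1 : 0 < p - 1 := Nat.sub_pos_of_lt (Fact.out : p.Prime).one_lt
  have hdvd : ∀ i, d i ∣ Fintype.card Eˣ := by
    intro i
    refine (hd i).trans ?_
    rw [Fintype.card_units, ← Nat.card_eq_fintype_card,
      Module.natCard_eq_pow_finrank (K := ZMod p), Nat.card_zmod]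
    simpa using Nat.sub_dvd_pow_sub_pow p 1 (Module.finrank (ZMod p) E)
  rw [sum_torusPow h (fun u i => ∑ t ∈ range (d i), ((normChar p E u ^ ((p - 1) / d i) :
      (PadicAlgCl p)ˣ) : PadicAlgCl p) ^ t) ?_ (fun y => ∏ j, g j (y j))]
  · have h1 : ∀ y : Fin n → Eˣ, (∏ i, ∑ t ∈ range (d i),
        ((normChar p E (torusPow (Q : Matrix (Fin n) (Fin n) ℤ) y i) ^ ((p - 1) / d i) :
          (PadicAlgCl p)ˣ) : PadicAlgCl p) ^ t) * ∏ j, g j (y j) =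
        ∑ s : (i : Fin n) → Fin (d i), ∏ j, (normChar p E (y j) : PadicAlgCl p) ^
          charExponent p (Q : Matrix (Fin n) (Fin n) ℤ) s j * g j (y j) := by
      intro y
      rw [prod_sum_normChar, Finset.sum_mul]
      exact Finset.sum_congr rfl fun s _ => Finset.prod_mul_distrib.symm
    rw [Finset.sum_congr rfl fun y _ => h1 y, Finset.sum_comm]
    refine Finset.sum_congr rfl fun s _ => ?_
    rw [Finset.prod_univ_sum, Fintype.piFinset_univ]
  · intro i H
    refine sum_comp_pow_of_isCyclic (hdvd i) ((Units.coeHom (PadicAlgCl p)).comp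
      ((powMonoidHom ((p - 1) / d i)).comp (normChar p E))) (fun u => ?_) H
    rw [← normChar_pow_eq_one_iff p (hd i) u]
    exact Units.val_eq_one

theorem sum_units_eq_sum {E C : Type*} [Field E] [Fintype E] [DecidableEq E] [AddCommMonoid C]
    (f : E → C) (hf : f 0 = 0) : ∑ y : Eˣ, f y = ∑ x, f x := by
  rw [← Finset.sum_subset (Finset.subset_univ (univ.filter fun x : E => x ≠ 0))]
  · refine Finset.sum_bij (fun (y : Eˣ) _ => (y : E)) ?_ ?_ ?_ ?_
    · intro y _
      simp
    · intro y _ y' _ h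
      exact Units.ext h
    · intro x hx
      exact ⟨Units.mk0 x (mem_filter.1 hx).2, mem_univ _, rfl⟩
    · intro y _
      rfl
  · intro x _ hx
    have : x = 0 := by simpa using hx
    rw [this, hf]

omit [Fact p.Prime] in
theorem addChar_map_sum {A C ι : Type*} [AddCommMonoid A] [CommMonoid C] (ψ : AddChar A C)
    (s : Finset ι) (f : ι → A) : ψ (∑ i ∈ s, f i) = ∏ i ∈ s, ψ (f i) := by
  classical
  induction s using Finset.induction_on with
  | empty => simp
  | insert a s ha ih => rw [Finset.sum_insert ha, Finset.prod_insert ha, ψ.map_add_eq_mul, ih]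

theorem zmodChar_ne_one {ζ : PadicAlgCl p} (hζ : IsPrimitiveRoot ζ p) :
    AddChar.zmodChar p hζ.pow_eq_one ≠ 1 := by
  intro h
  have := DFunLike.congr_fun h (1 : ZMod p)
  rw [AddChar.zmodChar_apply, ZMod.val_one, pow_one, AddChar.one_apply] at this
  exact hζ.ne_one (Fact.out : p.Prime).one_lt this

/-- Scaling by `α⁻¹` reduces to Hasse–Davenport. Passing between `Eˣ` and `E` is harmless even for
`k = 0`, since the trivial multiplicative character also vanishes at `0`. -/
theorem sum_normChar_mul_addChar {E : Type*} [Field E] [Fintype E] [DecidableEq E]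
    [Algebra (ZMod p) E]
    {ζ : PadicAlgCl p} (hζ : IsPrimitiveRoot ζ p) (k : ℕ) (α : Eˣ) :
    ∑ y : Eˣ, (normChar p E y : PadicAlgCl p) ^ k * AddChar.zmodChar p hζ.pow_eq_one
        (Algebra.trace (ZMod p) E (α * y)) =
      -(((normChar p E α)⁻¹ : (PadicAlgCl p)ˣ) : PadicAlgCl p) ^ k *
        (-∑ x, ((teichChar p)⁻¹ ^ k) x * AddChar.zmodChar p hζ.pow_eq_one x) ^
          Module.finrank (ZMod p) E := by
  rw [← hasse_davenport _ _ (zmodChar_ne_one hζ) (E := E), ← sum_units_eq_sum (fun x : E =>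
    ((teichChar p)⁻¹ ^ k) (Algebra.norm (ZMod p) x) *
      AddChar.zmodChar p hζ.pow_eq_one (Algebra.trace (ZMod p) E x))]
  · rw [neg_mul_neg, Finset.mul_sum, ← Equiv.sum_comp (Equiv.mulLeft α⁻¹)]
    refine Finset.sum_congr rfl fun y _ => ?_
    rw [teichChar_inv_pow_apply_unit, Equiv.coe_mulLeft, map_mul, map_inv, ← Units.val_mul,
      mul_inv_cancel_left, Units.val_mul, mul_pow, mul_assoc]
  · have : Module.Finite (ZMod p) E := Module.Finite.of_finite
    rw [Algebra.norm_zero, MulChar.map_zero, zero_mul]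

end CharSums

/-! ### The exponential sums as power sums of Gauss sum products -/

section ExpSum

variable {p : ℕ} [Fact p.Prime] {n : ℕ} {d : Fin n → ℕ} {F : Type*} [Field F] [Finite F]
  [Algebra (ZMod p) F]

/-- The reciprocal zeros of the signed L-function of a diagonal Laurent polynomial. -/
def reciprocalZero {ζ : PadicAlgCl p} (hζ : IsPrimitiveRoot ζ p) (Q : Matrix (Fin n) (Fin n) ℤ)
    (a : Fin n → Fˣ) (s : (i : Fin n) → Fin (d i)) : PadicAlgCl p :=
  ∏ j, (((normChar p F (a j))⁻¹ : (PadicAlgCl p)ˣ) : PadicAlgCl p) ^ charExponent p Q s j *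
    (-∑ x, ((teichChar p)⁻¹ ^ charExponent p Q s j) x * AddChar.zmodChar p hζ.pow_eq_one x) ^
      Module.finrank (ZMod p) F

theorem expSum_diagonal [CharP F p] {ζ : PadicAlgCl p} (hζ : IsPrimitiveRoot ζ p)
    {M : Matrix (Fin n) (Fin n) ℤ} {P Q : Matrix.GeneralLinearGroup (Fin n) ℤ}
    (h : (P : Matrix (Fin n) (Fin n) ℤ) * M * (Q : Matrix (Fin n) (Fin n) ℤ) =
        Matrix.diagonal fun i => (d i : ℤ)) (hd : ∀ i, d i ∣ p - 1)
    (a : Fin n → Fˣ) (k : ℕ) [NeZero k] :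
    expSum p ζ (diagonal M fun j => (a j : F)) k =
      (-1) ^ n * ∑ s : (i : Fin n) → Fin (d i),
        reciprocalZero hζ (Q : Matrix (Fin n) (Fin n) ℤ) a s ^ k := by
  classical
  set E := FiniteField.Extension F p k
  have : Fintype E := Fintype.ofFinite _
  set ψ := AddChar.zmodChar p hζ.pow_eq_one with hψ
  have h1 : expSum p ζ (diagonal M fun j => (a j : F)) k = ∑ x : Fin n → Eˣ,
      ∏ j, ψ (Algebra.trace (ZMod p) E ((Units.map (algebraMap F E : F →* E) (a j) : E) *
        ((torusPow M x j : Eˣ) : E))) := by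
    rw [expSum]
    refine Finset.sum_congr (by ext; simp) fun x _ => ?_
    rw [torusEval_diagonal, map_sum, ← AddChar.zmodChar_apply hζ.pow_eq_one, addChar_map_sum]
    rfl
  rw [h1, sum_torus_eq_sum_prod h hd fun j (y : Eˣ) =>
    ψ (Algebra.trace (ZMod p) E ((Units.map (algebraMap F E : F →* E) (a j) : E) * (y : E))), Finset.mul_sum]
  refine Finset.sum_congr rfl fun s _ => ?_
  simp_rw [hψ, sum_normChar_mul_addChar hζ]
  rw [reciprocalZero, ← Finset.prod_pow]
  have hn : ((-1 : PadicAlgCl p)) ^ n = ∏ _j : Fin n, (-1) := by simp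
  rw [hn, ← Finset.prod_mul_distrib]
  refine Finset.prod_congr rfl fun j _ => ?_
  -- By transitivity, the norm from `E` to `F_p` of an element of `F` is the `k`-th power of its
  -- norm from `F`. Hence the twists by `a j` are also `k`-th powers.
  have hnorm : normChar p E (Units.map (algebraMap F E : F →* E) (a j)) = normChar p F (a j) ^ k := by
    ext
    rw [Units.val_pow_eq_pow_val, normChar_apply, normChar_apply, Units.coe_map,
      MonoidHom.coe_coe, ← Algebra.norm_norm (S := F), Algebra.norm_algebraMap,
      FiniteField.finrank_extension, map_pow, map_pow]
  have hinv : ((((normChar p F (a j)) ^ k)⁻¹ : (PadicAlgCl p)ˣ) : PadicAlgCl p) =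
      (((normChar p F (a j))⁻¹ : (PadicAlgCl p)ˣ) : PadicAlgCl p) ^ k := by
    rw [← Units.val_pow_eq_pow_val, inv_pow]
  rw [hnorm, FiniteField.finrank_zmod_extension, hinv, mul_pow, ← pow_mul, ← pow_mul, ← pow_mul,
    mul_comm k]
  ring

end ExpSum

/-! ### The order of the reciprocal zeros -/

section Order

variable {p : ℕ} [Fact p.Prime] {n : ℕ} {d : Fin n → ℕ} {F : Type*} [Field F] [Finite F]
  [Algebra (ZMod p) F]

omit [Finite F] in
theorem norm_normChar_inv (u : Fˣ) :
    ‖(((normChar p F u)⁻¹ : (PadicAlgCl p)ˣ) : PadicAlgCl p)‖ = 1 := by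
  refine norm_eq_one_of_pow_eq_one_of_ne_zero (k := p - 1) ?_
    (Nat.sub_pos_of_lt (Fact.out : p.Prime).one_lt).ne'
  rw [← Units.val_pow_eq_pow_val, inv_pow, normChar_pow_card_sub_one, inv_one, Units.val_one]

omit [Finite F] in
theorem norm_reciprocalZero {ζ : PadicAlgCl p} (hζ : IsPrimitiveRoot ζ p)
    (Q : Matrix (Fin n) (Fin n) ℤ) (a : Fin n → Fˣ) (s : (i : Fin n) → Fin (d i)) :
    ‖reciprocalZero hζ Q a s‖ =
      ‖ζ - 1‖ ^ ((∑ j, charExponent p Q s j) * Module.finrank (ZMod p) F) := by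
  rw [reciprocalZero, norm_prod, Finset.sum_mul, ← Finset.prod_pow_eq_pow_sum]
  refine Finset.prod_congr rfl fun j _ => ?_
  rw [norm_mul, norm_pow, norm_normChar_inv, one_pow, one_mul, norm_pow, norm_neg,
    norm_gauss_sum hζ (charExponent_lt (Fact.out : p.Prime).one_lt Q s j), pow_mul]

theorem norm_sub_one_pos {ζ : PadicAlgCl p} (hζ : IsPrimitiveRoot ζ p) : 0 < ‖ζ - 1‖ :=
  norm_pos_iff.2 (sub_ne_zero.2 (hζ.ne_one (Fact.out : p.Prime).one_lt))

omit [Finite F] in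
theorem reciprocalZero_ne_zero {ζ : PadicAlgCl p} (hζ : IsPrimitiveRoot ζ p)
    (Q : Matrix (Fin n) (Fin n) ℤ) (a : Fin n → Fˣ) (s : (i : Fin n) → Fin (d i)) :
    reciprocalZero hζ Q a s ≠ 0 := by
  rw [← norm_pos_iff, norm_reciprocalZero]
  exact pow_pos (norm_sub_one_pos hζ) _

/-- The exponent `[F : F_p]` from Hasse–Davenport cancels against the normalization `ord_q q = 1`.
-/
theorem ordQ_reciprocalZero {ζ : PadicAlgCl p} (hζ : IsPrimitiveRoot ζ p)
    (Q : Matrix (Fin n) (Fin n) ℤ) (a : Fin n → Fˣ) (s : (i : Fin n) → Fin (d i)) :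
    ordQ p (Nat.card F) (reciprocalZero hζ Q a s) =
      (∑ j, (charExponent p Q s j : ℝ)) / ((p - 1 : ℕ) : ℝ) := by
  have hp : p.Prime := Fact.out
  have hp1 : (((p - 1 : ℕ)) : ℝ) ≠ 0 := by
    exact_mod_cast (Nat.sub_pos_of_lt hp.one_lt).ne'
  have hlog : Real.log p ≠ 0 := (Real.log_pos (by exact_mod_cast hp.one_lt)).ne'
  have hπ : ((p - 1 : ℕ) : ℝ) * Real.log ‖ζ - 1‖ = -Real.log p := by
    rw [← Real.log_pow, norm_sub_one_pow hζ, Real.log_inv]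
  have : FiniteDimensional (ZMod p) F := Module.Finite.of_finite
  have hfr : (Module.finrank (ZMod p) F : ℝ) ≠ 0 := by exact_mod_cast Module.finrank_pos.ne'
  have hπ' : Real.log ‖ζ - 1‖ = -Real.log p / ((p - 1 : ℕ) : ℝ) := by
    rw [eq_div_iff hp1, mul_comm, hπ]
  rw [ordQ, norm_reciprocalZero, Module.natCard_eq_pow_finrank (K := ZMod p), Nat.card_zmod,
    Nat.cast_pow, Real.log_pow, Real.log_pow, hπ']
  push_cast [hp.one_lt.le]
  push_cast [hp.one_lt.le] at hp1
  field_simp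

end Order

/-! ### The Newton polyhedron of a diagonal Laurent polynomial -/

section Simplex

variable {n : ℕ} (M : Matrix (Fin n) (Fin n) ℤ)

/-- An integral matrix viewed as a real matrix. -/
def realMatrix : Matrix (Fin n) (Fin n) ℝ := M.map (Int.cast : ℤ → ℝ)

/-- The coordinates of a real vector with respect to the columns of `M`. -/
def coords : (Fin n → ℝ) →ₗ[ℝ] (Fin n → ℝ) := ((realMatrix M)⁻¹).mulVecLin

/-- The column `j` of `M`, as a lattice point. -/
def column (j : Fin n) : Fin n → ℤ := fun i => M i j

/-- The sum of the coordinates, a linear form taking the value `1` at every column of `M`. -/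
def level : (Fin n → ℝ) →ₗ[ℝ] ℝ := (∑ j, LinearMap.proj j) ∘ₗ coords M

theorem level_apply (x : Fin n → ℝ) : level M x = ∑ j, coords M x j := by
  simp [level]

variable {M} (hM : M.det ≠ 0)

include hM

theorem isUnit_det_realMatrix : IsUnit (realMatrix M).det := by
  have : (realMatrix M).det = (M.det : ℝ) := ((Int.castRingHom ℝ).map_det M).symm
  rw [this, isUnit_iff_ne_zero]
  exact_mod_cast hM

theorem coords_mulVec (r : Fin n → ℝ) : coords M ((realMatrix M).mulVec r) = r := by
  rw [coords, Matrix.mulVecLin_apply, Matrix.mulVec_mulVec,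
    Matrix.nonsing_inv_mul _ (isUnit_det_realMatrix hM), Matrix.one_mulVec]

theorem mulVec_coords (x : Fin n → ℝ) : (realMatrix M).mulVec (coords M x) = x := by
  rw [coords, Matrix.mulVecLin_apply, Matrix.mulVec_mulVec,
    Matrix.mul_nonsing_inv _ (isUnit_det_realMatrix hM), Matrix.one_mulVec]

theorem coords_injective : Function.Injective (coords M) :=
  Function.LeftInverse.injective (mulVec_coords hM)

theorem coords_toReal_mulVec (t : Fin n → ℤ) : coords M (toReal (M.mulVec t)) = toReal t := by
  have : toReal (M.mulVec t) = (realMatrix M).mulVec (toReal t) := by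
    ext i
    simp [toReal, realMatrix, Matrix.mulVec, dotProduct]
  rw [this, coords_mulVec hM]

theorem coords_column (j : Fin n) : coords M (toReal (column M j)) = Pi.single j 1 := by
  have h : toReal (column M j) = (realMatrix M).mulVec (Pi.single j 1) := by
    ext i
    simp [toReal, realMatrix, column]
  rw [h, coords_mulVec hM]

theorem level_column (j : Fin n) : level M (toReal (column M j)) = 1 := by
  rw [level_apply, coords_column hM]
  simp

theorem sum_coords_smul_column (x : Fin n → ℝ) :
    ∑ j, coords M x j • toReal (column M j) = x := by
  refine coords_injective hM ?_
  rw [map_sum]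
  simp only [map_smul, coords_column hM]
  ext i
  simp [Finset.sum_apply, Pi.single_apply]

theorem span_range_column : Submodule.span ℝ (Set.range fun j => toReal (column M j)) = ⊤ := by
  rw [eq_top_iff]
  intro x _
  rw [← sum_coords_smul_column hM x]
  exact Submodule.sum_mem _ fun j _ => Submodule.smul_mem _ _ (Submodule.subset_span ⟨j, rfl⟩)

theorem column_injective : Function.Injective (column M) := by
  intro j j' h
  have h1 := coords_column hM j
  rw [h, coords_column hM j'] at h1
  by_contra hne
  have := congrFun h1 j
  simp [hne] at this

variable {F : Type*} [Field F] {a : Fin n → F} (ha : ∀ j, a j ≠ 0)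

include ha

theorem support_diagonal :
    ((diagonal M a).coeff.support : Set (Fin n → ℤ)) = Set.range (column M) := by
  classical
  have hc : ∀ v, (diagonal M a).coeff v = ∑ j, if column M j = v then a j else 0 := by
    intro v
    rw [diagonal, AddMonoidAlgebra.coeff_sum, Finsupp.finsetSum_apply]
    refine Finset.sum_congr rfl fun j _ => ?_
    rw [AddMonoidAlgebra.coeff_single, Finsupp.single_apply]
    rfl
  ext v
  rw [Finset.mem_coe, Finsupp.mem_support_iff, hc]
  constructor
  · intro h
    obtain ⟨j, -, hj⟩ := Finset.exists_ne_zero_of_sum_ne_zero h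
    refine ⟨j, ?_⟩
    by_contra hne
    exact hj (if_neg hne)
  · rintro ⟨j, rfl⟩
    rw [Finset.sum_eq_single j]
    · simpa using ha j
    · intro i _ hij
      exact if_neg fun h => hij (column_injective hM h)
    · intro h
      exact absurd (mem_univ j) h

theorem newtonPolyhedron_eq_convexHull : newtonPolyhedron (diagonal M a) =
    convexHull ℝ (insert 0 (Set.range fun j => toReal (column M j))) := by
  rw [newtonPolyhedron, support_diagonal hM ha, ← Set.range_comp]
  rfl

/-- The polyhedron is the simplex on `0` and the columns; the origin takes the leftover barycentric
weight `1 - level M x`. -/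
theorem mem_newtonPolyhedron_iff (x : Fin n → ℝ) :
    x ∈ newtonPolyhedron (diagonal M a) ↔ (∀ j, 0 ≤ coords M x j) ∧ level M x ≤ 1 := by
  rw [newtonPolyhedron_eq_convexHull hM ha]
  constructor
  · have hconv : Convex ℝ {x | (∀ j, 0 ≤ coords M x j) ∧ level M x ≤ 1} := by
      rintro x ⟨hx1, hx2⟩ y ⟨hy1, hy2⟩ b c hb hc hbc
      refine ⟨fun j => ?_, ?_⟩
      · simp only [map_add, map_smul, Pi.add_apply, Pi.smul_apply, smul_eq_mul]
        exact add_nonneg (mul_nonneg hb (hx1 j)) (mul_nonneg hc (hy1 j))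
      · simp only [map_add, map_smul, smul_eq_mul]
        nlinarith
    intro hx
    refine convexHull_min ?_ hconv hx
    rintro y (rfl | ⟨j, rfl⟩)
    · simp
    · refine ⟨fun i => ?_, (level_column hM j).le⟩
      simp only [coords_column hM, Pi.single_apply]
      split_ifs <;> norm_num
  · rintro ⟨h1, h2⟩
    rw [level_apply] at h2
    have := (convex_convexHull ℝ (insert 0 (Set.range fun j => toReal (column M j)))).sum_mem
      (t := univ) (w := fun o : Option (Fin n) => o.elim (1 - ∑ j, coords M x j) (coords M x))
      (z := fun o : Option (Fin n) => o.elim 0 fun j => toReal (column M j)) ?_ ?_ ?_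
    · rw [Fintype.sum_option] at this
      simpa [sum_coords_smul_column hM] using this
    · rintro (_ | j) _
      · simpa using h2
      · exact h1 j
    · rw [Fintype.sum_option]
      simp
    · rintro (_ | j) _
      · exact subset_convexHull ℝ _ (Set.mem_insert _ _)
      · exact subset_convexHull ℝ _ (Set.mem_insert_of_mem _ ⟨j, rfl⟩)

theorem affineSpan_newtonPolyhedron : affineSpan ℝ (newtonPolyhedron (diagonal M a)) = ⊤ := by
  rw [newtonPolyhedron_eq_convexHull hM ha, affineSpan_convexHull, ← AffineSubspace.coe_eq_univ_iff,
    affineSpan_insert_zero, span_range_column hM, Submodule.top_coe]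

open Pointwise in
theorem mem_smul_newtonPolyhedron_iff {c : ℝ} (hc : 0 ≤ c) (x : Fin n → ℝ) :
    x ∈ c • newtonPolyhedron (diagonal M a) ↔ (∀ j, 0 ≤ coords M x j) ∧ level M x ≤ c := by
  rw [Set.mem_smul_set]
  constructor
  · rintro ⟨y, hy, rfl⟩
    obtain ⟨h1, h2⟩ := (mem_newtonPolyhedron_iff hM ha y).1 hy
    simp only [map_smul, Pi.smul_apply, smul_eq_mul]
    exact ⟨fun j => mul_nonneg hc (h1 j), mul_le_of_le_one_right hc h2⟩
  · rintro ⟨h1, h2⟩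
    rcases hc.eq_or_lt with rfl | hc
    · refine ⟨0, (mem_newtonPolyhedron_iff hM ha 0).2 (by simp), ?_⟩
      rw [smul_zero]
      refine coords_injective hM ?_
      rw [level_apply] at h2
      have h3 := (Finset.sum_eq_zero_iff_of_nonneg fun j _ => h1 j).1
        (le_antisymm h2 (Finset.sum_nonneg fun j _ => h1 j))
      ext j
      rw [h3 j (mem_univ j), map_zero, Pi.zero_apply]
    · refine ⟨c⁻¹ • x, (mem_newtonPolyhedron_iff hM ha _).2 ?_, smul_inv_smul₀ hc.ne' x⟩
      simp only [map_smul, Pi.smul_apply, smul_eq_mul]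
      refine ⟨fun j => mul_nonneg (inv_nonneg.2 hc.le) (h1 j), ?_⟩
      rw [inv_mul_le_iff₀ hc, mul_one]
      exact h2

open Pointwise in
theorem weight_eq_coe_iff (x : Fin n → ℝ) (c : ℝ) :
    weight (newtonPolyhedron (diagonal M a)) x = (c : EReal) ↔
      (∀ j, 0 ≤ coords M x j) ∧ level M x = c := by
  rw [weight]
  by_cases h : ∀ j, 0 ≤ coords M x j
  · have h0 : 0 ≤ level M x := by
      rw [level_apply]
      exact Finset.sum_nonneg fun j _ => h j
    have hw : (⨅ c ∈ {c : ℝ | 0 ≤ c ∧ x ∈ c • newtonPolyhedron (diagonal M a)}, (c : EReal)) =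
        (level M x : EReal) := by
      refine le_antisymm ?_ ?_
      · exact iInf₂_le (level M x)
          ⟨h0, (mem_smul_newtonPolyhedron_iff hM ha h0 x).2 ⟨h, le_rfl⟩⟩
      · refine le_iInf₂ fun c hc => ?_
        exact EReal.coe_le_coe_iff.2 ((mem_smul_newtonPolyhedron_iff hM ha hc.1 x).1 hc.2).2
    rw [hw, EReal.coe_eq_coe_iff]
    exact ⟨fun h' => ⟨h, h'⟩, fun h' => h'.2⟩
  · refine ⟨fun hw => ?_, fun h' => absurd h'.1 h⟩
    have : (⨅ c ∈ {c : ℝ | 0 ≤ c ∧ x ∈ c • newtonPolyhedron (diagonal M a)}, (c : EReal)) = ⊤ := by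
      refine iInf₂_eq_top.2 fun c hc => ?_
      exact absurd ((mem_smul_newtonPolyhedron_iff hM ha hc.1 x).1 hc.2).1 h
    rw [this] at hw
    exact absurd hw.symm (EReal.coe_ne_top c)

omit hM ha in
theorem sum_mul_eq_dotProduct_level (x : Fin n → ℝ) :
    ∑ i, (Matrix.vecMul 1 (realMatrix M)⁻¹) i * x i = level M x := by
  change dotProduct (Matrix.vecMul 1 (realMatrix M)⁻¹) x = _
  rw [← Matrix.dotProduct_mulVec, level_apply, coords]
  simp [dotProduct]

/-- The simplex has a single facet away from the origin, namely the one spanned by the columns. -/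
theorem isFacetEquation_iff (e : Fin n → ℝ) :
    IsFacetEquation (newtonPolyhedron (diagonal M a)) e ↔
      e = Matrix.vecMul 1 (realMatrix M)⁻¹ := by
  have hcol : ∀ j, toReal (column M j) ∈ newtonPolyhedron (diagonal M a) := fun j => by
    rw [newtonPolyhedron_eq_convexHull hM ha]
    exact subset_convexHull ℝ _ (Set.mem_insert_of_mem _ ⟨j, rfl⟩)
  constructor
  · rintro ⟨h1, h2⟩
    have hone : ∀ j, ∑ i, e i * toReal (column M j) i = 1 := by
      intro j
      refine le_antisymm (h1 _ (hcol j)) (not_lt.1 fun hlt => ?_)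
      -- If `e` is less than `1` at column `j`, points of the face have `j`-th coordinate zero, so
      -- their span is contained in a hyperplane.
      have hsub : Submodule.span ℝ {x ∈ newtonPolyhedron (diagonal M a) | ∑ i, e i * x i = 1} ≤
          LinearMap.ker ((LinearMap.proj j : (Fin n → ℝ) →ₗ[ℝ] ℝ) ∘ₗ coords M) := by
        refine Submodule.span_le.2 ?_
        rintro x ⟨hx, hx1⟩
        obtain ⟨hx0, hxl⟩ := (mem_newtonPolyhedron_iff hM ha x).1 hx
        have hexp : ∑ k, coords M x k * ∑ i, e i * toReal (column M k) i = 1 := by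
          rw [← hx1]
          conv_rhs => rw [← sum_coords_smul_column hM x]
          simp only [Finset.sum_apply, Pi.smul_apply, smul_eq_mul, Finset.mul_sum]
          rw [Finset.sum_comm]
          exact Finset.sum_congr rfl fun i _ => Finset.sum_congr rfl fun k _ => by ring
        rw [level_apply] at hxl
        have hnn : ∀ k ∈ univ, 0 ≤ coords M x k * (1 - ∑ i, e i * toReal (column M k) i) :=
          fun k _ => mul_nonneg (hx0 k) (sub_nonneg.2 (h1 _ (hcol k)))
        have hz := (Finset.sum_eq_zero_iff_of_nonneg hnn).1 (le_antisymm (by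
          simp only [mul_sub, mul_one, Finset.sum_sub_distrib, hexp]
          linarith) (Finset.sum_nonneg hnn)) j (mem_univ j)
        have := (mul_eq_zero.1 hz).resolve_right (sub_pos.2 hlt).ne'
        simpa using this
      rw [h2] at hsub
      have := hsub (Submodule.mem_top (x := toReal (column M j)))
      simp [coords_column hM] at this
    ext i
    have hvec : Matrix.vecMul e (realMatrix M) = 1 := by
      ext j
      exact hone j
    rw [← hvec, Matrix.vecMul_vecMul, Matrix.mul_nonsing_inv _ (isUnit_det_realMatrix hM),
      Matrix.vecMul_one]
  · rintro rfl
    refine ⟨fun x hx => ?_, ?_⟩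
    · rw [sum_mul_eq_dotProduct_level]
      exact ((mem_newtonPolyhedron_iff hM ha x).1 hx).2
    · rw [eq_top_iff, ← span_range_column hM]
      refine Submodule.span_mono ?_
      rintro _ ⟨j, rfl⟩
      exact ⟨hcol j, by rw [sum_mul_eq_dotProduct_level, level_column hM]⟩

/-- Since `M⁻¹` is the adjugate divided by the determinant, `|det M|` clears all denominators. So
the infimum runs over a nonempty set and is attained. -/
theorem denominator_spec : 0 < denominator (newtonPolyhedron (diagonal M a)) ∧
    ∀ u : Fin n → ℤ, ∃ z : ℤ,
      (denominator (newtonPolyhedron (diagonal M a)) : ℝ) * level M (toReal u) = z := by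
  have hne : {m : ℕ | 0 < m ∧ ∀ e, IsFacetEquation (newtonPolyhedron (diagonal M a)) e →
      ∀ i, ∃ z : ℤ, (m : ℝ) * e i = z}.Nonempty := by
    refine ⟨M.det.natAbs, Int.natAbs_pos.2 hM, ?_⟩
    intro e he i
    rw [(isFacetEquation_iff hM ha e).1 he]
    have hdet : (realMatrix M).det = (M.det : ℝ) := ((Int.castRingHom ℝ).map_det M).symm
    have hadj : (realMatrix M).adjugate = M.adjugate.map (Int.cast : ℤ → ℝ) :=
      ((Int.castRingHom ℝ).map_adjugate M).symm
    have hdet0 : (M.det : ℝ) ≠ 0 := by exact_mod_cast hM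
    have hval : (M.det : ℝ) * Matrix.vecMul 1 (realMatrix M)⁻¹ i =
        ((∑ j, M.adjugate j i : ℤ) : ℝ) := by
      rw [Matrix.inv_def, hdet, Ring.inverse_eq_inv', hadj, Matrix.vecMul_smul, Pi.smul_apply,
        smul_eq_mul, mul_inv_cancel_left₀ hdet0]
      simp [Matrix.vecMul, dotProduct]
    rcases Int.natAbs_eq M.det with h | h
    · refine ⟨∑ j, M.adjugate j i, ?_⟩
      rw [← hval]
      conv_rhs => rw [h]
      rw [Int.cast_natCast]
    · refine ⟨-∑ j, M.adjugate j i, ?_⟩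
      rw [Int.cast_neg, ← hval]
      conv_rhs => rw [h]
      rw [Int.cast_neg, Int.cast_natCast]
      ring
  obtain ⟨h1, h2⟩ := Nat.sInf_mem hne
  refine ⟨h1, fun u => ?_⟩
  choose z hz using h2 _ ((isFacetEquation_iff hM ha _).2 rfl)
  refine ⟨∑ i, z i * u i, ?_⟩
  rw [← sum_mul_eq_dotProduct_level, Finset.mul_sum]
  push_cast
  refine Finset.sum_congr rfl fun i _ => ?_
  rw [← hz i, ← mul_assoc]
  rfl

end Simplex

/-! ### Hodge numbers of the simplex -/

section Hodge

variable {n : ℕ} (M : Matrix (Fin n) (Fin n) ℤ)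

/-- The lattice points of the cone spanned by the columns of `M` on which `level M` takes the
value `c`. -/
def latticeLevel (c : ℝ) : Set (Fin n → ℤ) :=
  {u | (∀ j, 0 ≤ coords M (toReal u) j) ∧ level M (toReal u) = c}

theorem toReal_add (u v : Fin n → ℤ) : toReal (u + v) = toReal u + toReal v := by
  ext i
  simp [toReal]

theorem toReal_injective : Function.Injective (toReal : (Fin n → ℤ) → Fin n → ℝ) := fun u v h => by
  ext i
  exact Int.cast_injective (congrFun h i)

variable {M} (hM : M.det ≠ 0)

include hM

/-- Finiteness is needed because `Set.ncard` is zero on infinite sets. At level `c` all coordinates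
lie in `[0, c]`. -/
theorem finite_latticeLevel (c : ℝ) : (latticeLevel M c).Finite := by
  obtain ⟨B, hB⟩ : ∃ B : ℤ, ∀ i, ∑ j, |(M i j : ℝ)| * c ≤ B := by
    obtain ⟨B, hB⟩ := (Set.finite_range fun i => ∑ j, |(M i j : ℝ)| * c).bddAbove
    exact ⟨⌈B⌉, fun i => (hB ⟨i, rfl⟩).trans (Int.le_ceil B)⟩
  refine (Set.finite_Icc (fun _ : Fin n => -B) (fun _ => B)).subset ?_
  rintro u ⟨h1, h2⟩
  have hle : ∀ j, coords M (toReal u) j ≤ c := by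
    intro j
    rw [← h2, level_apply]
    exact Finset.single_le_sum (fun k _ => h1 k) (mem_univ j)
  have habs : ∀ i, |(u i : ℝ)| ≤ B := by
    intro i
    have hu : (u i : ℝ) = ∑ j, (M i j : ℝ) * coords M (toReal u) j :=
      (congrFun (mulVec_coords hM (toReal u)) i).symm
    rw [hu]
    refine (Finset.abs_sum_le_sum_abs _ _).trans ((Finset.sum_le_sum fun j _ => ?_).trans (hB i))
    rw [abs_mul, abs_of_nonneg (h1 j)]
    exact mul_le_mul_of_nonneg_left (hle j) (abs_nonneg _)
  constructor
  · intro i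
    exact_mod_cast (abs_le.1 (habs i)).1
  · intro i
    exact_mod_cast (abs_le.1 (habs i)).2

/-- Translation by the sum of the columns indexed by `I` is a bijection between the two sets. -/
theorem ncard_latticeLevel_sub (c : ℝ) (I : Finset (Fin n)) :
    (latticeLevel M (c - I.card)).ncard =
      {u ∈ latticeLevel M c | ∀ j ∈ I, 1 ≤ coords M (toReal u) j}.ncard := by
  classical
  set t : Fin n → ℤ := fun j => if j ∈ I then 1 else 0 with ht
  have hco : ∀ u j, coords M (toReal (u + M.mulVec t)) j = coords M (toReal u) j + t j := by
    intro u j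
    rw [toReal_add, map_add, coords_toReal_mulVec hM]
    rfl
  have hlev : ∀ u, level M (toReal (u + M.mulVec t)) = level M (toReal u) + I.card := by
    intro u
    rw [level_apply, level_apply, Finset.sum_congr rfl fun j _ => hco u j,
      Finset.sum_add_distrib]
    simp [ht]
  have himg : {u ∈ latticeLevel M c | ∀ j ∈ I, 1 ≤ coords M (toReal u) j} =
      (fun u => u + M.mulVec t) '' latticeLevel M (c - I.card) := by
    ext u
    constructor
    · rintro ⟨⟨h1, h2⟩, h3⟩
      have hu : u - M.mulVec t + M.mulVec t = u := sub_add_cancel _ _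
      refine ⟨u - M.mulVec t, ⟨fun j => ?_, ?_⟩, hu⟩
      · have := hco (u - M.mulVec t) j
        rw [hu] at this
        by_cases hj : j ∈ I
        · have h4 := h3 j hj
          simp only [ht, hj, if_true, Int.cast_one] at this
          linarith
        · have h4 := h1 j
          simp only [ht, hj, if_false, Int.cast_zero] at this
          linarith
      · have := hlev (u - M.mulVec t)
        rw [hu] at this
        linarith
    · rintro ⟨u, ⟨h1, h2⟩, rfl⟩
      refine ⟨⟨fun j => ?_, ?_⟩, fun j hj => ?_⟩
      · rw [hco]
        refine add_nonneg (h1 j) ?_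
        simp only [ht]
        split_ifs <;> simp
      · rw [hlev, h2, sub_add_cancel]
      · rw [hco]
        simp only [ht, hj, if_true, Int.cast_one]
        linarith [h1 j]
  rw [himg, Set.ncard_image_of_injective _ (add_left_injective _)]

/-- Inclusion–exclusion over the set of coordinates that are at least `1`; only points for which
that set is empty survive. -/
theorem sum_choose_mul_ncard_latticeLevel (c : ℝ) :
    ∑ i ∈ range (n + 1), (-1) ^ i * (n.choose i : ℤ) * ((latticeLevel M (c - i)).ncard : ℤ) =
      ({u ∈ latticeLevel M c | ∀ j, coords M (toReal u) j < 1}.ncard : ℤ) := by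
  classical
  set A : Finset (Fin n → ℤ) := (finite_latticeLevel hM c).toFinset with hA
  set J : (Fin n → ℤ) → Finset (Fin n) := fun u =>
    univ.filter fun j => 1 ≤ coords M (toReal u) j with hJ
  have hcount : ∀ I : Finset (Fin n), ((latticeLevel M (c - I.card)).ncard : ℤ) =
      ∑ u ∈ A, if I ⊆ J u then 1 else 0 := by
    intro I
    rw [ncard_latticeLevel_sub hM, Finset.sum_boole, Int.natCast_inj, ← Set.ncard_coe_finset]
    congr 1
    ext u
    simp [hA, hJ, Finset.subset_iff]
  have h1 := Finset.sum_powerset_apply_card (x := (univ : Finset (Fin n)))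
    (fun i => (-1 : ℤ) ^ i * ((latticeLevel M (c - i)).ncard : ℤ))
  rw [Finset.card_univ, Fintype.card_fin] at h1
  have h2 : ∑ i ∈ range (n + 1), (-1) ^ i * (n.choose i : ℤ) *
      ((latticeLevel M (c - i)).ncard : ℤ) =
      ∑ i ∈ range (n + 1), n.choose i • ((-1 : ℤ) ^ i * ((latticeLevel M (c - i)).ncard : ℤ)) :=
    Finset.sum_congr rfl fun i _ => by rw [nsmul_eq_mul]; ring
  rw [h2, ← h1]
  simp_rw [hcount, Finset.mul_sum]
  rw [Finset.sum_comm]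
  have h3 : ∀ u ∈ A, ∑ I ∈ (univ : Finset (Fin n)).powerset,
      ((-1 : ℤ) ^ I.card * if I ⊆ J u then 1 else 0) = if J u = ∅ then 1 else 0 := by
    intro u _
    rw [← Finset.sum_powerset_neg_one_pow_card]
    simp only [mul_ite, mul_one, mul_zero]
    rw [← Finset.sum_filter]
    congr 1
    ext I
    simp
  rw [Finset.sum_congr rfl h3, Finset.sum_boole, Int.natCast_inj, ← Set.ncard_coe_finset]
  congr 1
  ext u
  simp [hA, hJ, Finset.filter_eq_empty_iff]

variable {F : Type*} [Field F] {a : Fin n → F} (ha : ∀ j, a j ≠ 0)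

include ha

theorem hodgeNumber_eq_ncard (k : ℕ) : hodgeNumber (newtonPolyhedron (diagonal M a)) k =
    ({u ∈ latticeLevel M (k / denominator (newtonPolyhedron (diagonal M a))) |
      ∀ j, coords M (toReal u) j < 1}.ncard : ℤ) := by
  have hD : (denominator (newtonPolyhedron (diagonal M a)) : ℝ) ≠ 0 := by
    exact_mod_cast (denominator_spec hM ha).1.ne'
  rw [← sum_choose_mul_ncard_latticeLevel hM, hodgeNumber]
  refine Finset.sum_congr rfl fun i _ => ?_
  rw [weightCount]
  congr 3
  ext u
  rw [Set.mem_ofPred_eq, weight_eq_coe_iff hM ha]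
  have : (((k : ℤ) - (i : ℤ) * (denominator (newtonPolyhedron (diagonal M a)) : ℤ) : ℤ) : ℝ) /
      denominator (newtonPolyhedron (diagonal M a)) =
      k / denominator (newtonPolyhedron (diagonal M a)) - i := by
    push_cast
    field_simp
  rw [this]
  rfl

end Hodge

/-! ### Lattice points of the fundamental parallelepiped -/

section Box

variable {p n : ℕ} {d : Fin n → ℕ} {M : Matrix (Fin n) (Fin n) ℤ}
  {P Q : Matrix.GeneralLinearGroup (Fin n) ℤ}

/-- From `M⁻¹ = Q diag(d)⁻¹ P` the coordinates of `u` are `Q (w_i / d_i + x_i)_i`. Multiplying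
through by `p - 1` keeps the computation over the integers. -/
theorem coords_of_smith (hM : M.det ≠ 0)
    (h : (P : Matrix (Fin n) (Fin n) ℤ) * M * (Q : Matrix (Fin n) (Fin n) ℤ) =
        Matrix.diagonal fun i => (d i : ℤ)) (hp : 1 < p) (hd : ∀ i, d i ∣ p - 1)
    {u w x : Fin n → ℤ}
    (hu : (P : Matrix (Fin n) (Fin n) ℤ).mulVec u = fun i => w i + d i * x i) :
    coords M (toReal u) = fun j => ((((∑ i, (Q : Matrix (Fin n) (Fin n) ℤ) j i *
      (((p - 1) / d i : ℕ) * w i)) + ((p - 1 : ℕ) : ℤ) *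
        (Q : Matrix (Fin n) (Fin n) ℤ).mulVec x j : ℤ)) : ℝ) / ((p - 1 : ℕ) : ℝ) := by
  set Y : Fin n → ℤ := (Q : Matrix (Fin n) (Fin n) ℤ).mulVec
    (fun i => ((p - 1) / d i : ℕ) * w i + ((p - 1 : ℕ) : ℤ) * x i) with hY
  have hp1 : ((p - 1 : ℕ) : ℝ) ≠ 0 := by
    exact_mod_cast (Nat.sub_pos_of_lt hp).ne'
  have hPinj : Function.Injective (P : Matrix (Fin n) (Fin n) ℤ).mulVec :=
    Matrix.mulVec_injective_of_isUnit P.isUnit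
  have h1 : ((p - 1 : ℕ) : ℤ) • u = M.mulVec Y := by
    refine hPinj ?_
    rw [hY, Matrix.mulVec_mulVec, Matrix.mulVec_mulVec, h, Matrix.mulVec_smul, hu]
    ext i
    rw [Matrix.mulVec_diagonal, Pi.smul_apply, smul_eq_mul]
    have : (d i : ℤ) * ((p - 1) / d i : ℕ) = ((p - 1 : ℕ) : ℤ) := by
      exact_mod_cast Nat.mul_div_cancel' (hd i)
    linear_combination (-(w i)) * this
  have h2 : ((p - 1 : ℕ) : ℝ) • coords M (toReal u) = toReal Y := by
    rw [← coords_toReal_mulVec hM Y, ← h1, ← map_smul]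
    congr 1
    ext i
    simp [toReal]
  ext j
  rw [eq_div_iff hp1, mul_comm]
  have h3 := congrFun h2 j
  rw [Pi.smul_apply, smul_eq_mul] at h3
  rw [h3, toReal, Int.cast_inj, hY, Matrix.mulVec, Matrix.mulVec, dotProduct, dotProduct,
    Finset.mul_sum, ← Finset.sum_add_distrib]
  exact Finset.sum_congr rfl fun i _ => by ring

/-- Reducing `P u` modulo the `d i` identifies `ℤ^n / M ℤ^n` with the tuples `s`, and each class has
a unique representative with all coordinates in `[0, 1)`. -/
theorem exists_boxPoint (hM : M.det ≠ 0)
    (h : (P : Matrix (Fin n) (Fin n) ℤ) * M * (Q : Matrix (Fin n) (Fin n) ℤ) =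
        Matrix.diagonal fun i => (d i : ℤ)) (hp : 1 < p) (hd : ∀ i, d i ∣ p - 1) :
    ∃ b : ((i : Fin n) → Fin (d i)) → Fin n → ℤ, Function.Injective b ∧
      (∀ s j, coords M (toReal (b s)) j =
        charExponent p (Q : Matrix (Fin n) (Fin n) ℤ) s j / ((p - 1 : ℕ) : ℝ)) ∧
      ∀ u, (∀ j, 0 ≤ coords M (toReal u) j ∧ coords M (toReal u) j < 1) → ∃ s, b s = u := by
  have hp1 : 0 < p - 1 := Nat.sub_pos_of_lt hp
  have hp1' : (0 : ℝ) < ((p - 1 : ℕ) : ℝ) := by exact_mod_cast hp1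
  have hd0 : ∀ i, 0 < d i := fun i => Nat.pos_of_dvd_of_pos (hd i) hp1
  set Z : ((i : Fin n) → Fin (d i)) → Fin n → ℤ := fun s j =>
    ∑ i, (Q : Matrix (Fin n) (Fin n) ℤ) j i * (((p - 1) / d i : ℕ) * (s i : ℕ)) with hZ
  have hκ : ∀ s j, (charExponent p (Q : Matrix (Fin n) (Fin n) ℤ) s j : ℤ) =
      Z s j % ((p - 1 : ℕ) : ℤ) := by
    intro s j
    rw [charExponent_cast hp]
    simp only [hZ, Nat.cast_mul]
  have hQi : ∀ y, (Q : Matrix (Fin n) (Fin n) ℤ).mulVec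
      (((Q⁻¹ : Matrix.GeneralLinearGroup (Fin n) ℤ) : Matrix (Fin n) (Fin n) ℤ).mulVec y) = y := by
    intro y
    rw [Matrix.mulVec_mulVec, Units.mul_inv, Matrix.one_mulVec]
  have hQinj : Function.Injective (Q : Matrix (Fin n) (Fin n) ℤ).mulVec :=
    Matrix.mulVec_injective_of_isUnit Q.isUnit
  have hPi : ∀ y, (P : Matrix (Fin n) (Fin n) ℤ).mulVec
      (((P⁻¹ : Matrix.GeneralLinearGroup (Fin n) ℤ) : Matrix (Fin n) (Fin n) ℤ).mulVec y) = y := by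
    intro y
    rw [Matrix.mulVec_mulVec, Units.mul_inv, Matrix.one_mulVec]
  -- Chosen so that `Q X` subtracts the integer parts of the coordinates, leaving the fractional
  -- parts `charExponent / (p - 1)`.
  set X : ((i : Fin n) → Fin (d i)) → Fin n → ℤ := fun s =>
    ((Q⁻¹ : Matrix.GeneralLinearGroup (Fin n) ℤ) : Matrix (Fin n) (Fin n) ℤ).mulVec
      fun j => -(Z s j / ((p - 1 : ℕ) : ℤ)) with hX
  set b : ((i : Fin n) → Fin (d i)) → Fin n → ℤ := fun s =>
    ((P⁻¹ : Matrix.GeneralLinearGroup (Fin n) ℤ) : Matrix (Fin n) (Fin n) ℤ).mulVec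
      fun i => ((s i : ℕ) : ℤ) + d i * X s i with hb
  have hcb : ∀ s j, coords M (toReal (b s)) j =
      charExponent p (Q : Matrix (Fin n) (Fin n) ℤ) s j / ((p - 1 : ℕ) : ℝ) := by
    intro s j
    rw [coords_of_smith hM h hp hd (hPi _), ← Int.cast_natCast (charExponent _ _ _ _), hκ, hX,
      hQi]
    change ((Z s j + _ : ℤ) : ℝ) / _ = _
    congr 2
    rw [Int.emod_def]
    ring
  have hinj : ∀ s s' : (i : Fin n) → Fin (d i), (∀ j, charExponent p (Q : Matrix (Fin n) (Fin n) ℤ) s j =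
      charExponent p (Q : Matrix (Fin n) (Fin n) ℤ) s' j) → s = s' := by
    intro s s' hss
    have hmod : ∀ j, ((p - 1 : ℕ) : ℤ) ∣ Z s j - Z s' j := by
      intro j
      refine Int.ModEq.dvd ?_
      rw [Int.ModEq, ← hκ, ← hκ, hss]
    choose y hy using hmod
    have hQe : (Q : Matrix (Fin n) (Fin n) ℤ).mulVec
        (fun i => (((p - 1) / d i : ℕ) : ℤ) * ((s i : ℕ) - (s' i : ℕ) : ℤ)) =
        (Q : Matrix (Fin n) (Fin n) ℤ).mulVec (((p - 1 : ℕ) : ℤ) •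
          (((Q⁻¹ : Matrix.GeneralLinearGroup (Fin n) ℤ) : Matrix (Fin n) (Fin n) ℤ).mulVec y)) := by
      rw [Matrix.mulVec_smul, hQi]
      ext j
      rw [Pi.smul_apply, smul_eq_mul, ← hy, Matrix.mulVec, dotProduct, hZ,
        ← Finset.sum_sub_distrib]
      exact Finset.sum_congr rfl fun i _ => by ring
    have he := hQinj hQe
    ext i
    have hi := congrFun he i
    rw [Pi.smul_apply, smul_eq_mul] at hi
    obtain ⟨e, hde⟩ := hd i
    have he0 : 0 < e := Nat.pos_of_mul_pos_left (hde ▸ hp1)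
    rw [hde, Nat.mul_div_cancel_left _ (hd0 i)] at hi
    have hdvd : (d i : ℤ) ∣ ((s i : ℕ) : ℤ) - (s' i : ℕ) := by
      generalize (((Q⁻¹ : Matrix.GeneralLinearGroup (Fin n) ℤ) :
        Matrix (Fin n) (Fin n) ℤ).mulVec y) i = c at hi
      refine ⟨c, mul_left_cancel₀ (by exact_mod_cast he0.ne' : (e : ℤ) ≠ 0) (hi.trans ?_)⟩
      push_cast
      ring
    have hzero := Int.eq_zero_of_abs_lt_dvd hdvd (by
      have := (s i).isLt
      have := (s' i).isLt
      rw [abs_lt]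
      omega)
    omega
  refine ⟨b, fun s s' hss => hinj s s' fun j => ?_, hcb, ?_⟩
  · have h1 := hcb s j
    rw [hss, hcb s' j, div_left_inj' hp1'.ne'] at h1
    exact_mod_cast h1.symm
  · intro u hu
    -- The class of `u`. Its coordinates agree with those of `b s` modulo `1`, hence exactly, since
    -- both lie in `[0, 1)`.
    set s : (i : Fin n) → Fin (d i) := fun i =>
      ⟨((P : Matrix (Fin n) (Fin n) ℤ).mulVec u i % d i).toNat, by
        have h1 := Int.emod_lt_of_pos ((P : Matrix (Fin n) (Fin n) ℤ).mulVec u i)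
          (by exact_mod_cast hd0 i : (0 : ℤ) < d i)
        have h2 := Int.emod_nonneg ((P : Matrix (Fin n) (Fin n) ℤ).mulVec u i)
          (by exact_mod_cast (hd0 i).ne' : (d i : ℤ) ≠ 0)
        omega⟩ with hs
    have hPu : (P : Matrix (Fin n) (Fin n) ℤ).mulVec u =
        fun i => ((s i : ℕ) : ℤ) + d i * ((P : Matrix (Fin n) (Fin n) ℤ).mulVec u i / d i) := by
      ext i
      have h2 := Int.emod_nonneg ((P : Matrix (Fin n) (Fin n) ℤ).mulVec u i)
        (by exact_mod_cast (hd0 i).ne' : (d i : ℤ) ≠ 0)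
      simp only [hs, Int.toNat_of_nonneg h2, Int.emod_add_mul_ediv]
    have hcu := coords_of_smith hM h hp hd hPu
    refine ⟨s, toReal_injective (coords_injective hM ?_)⟩
    ext j
    obtain ⟨hu1, hu2⟩ := hu j
    rw [hcb, ← Int.cast_natCast (charExponent _ _ _ _), hκ]
    rw [hcu] at hu1 hu2 ⊢
    rw [div_lt_one hp1'] at hu2
    rw [le_div_iff₀ hp1', zero_mul] at hu1
    congr 2
    change Z s j % _ = Z s j + _
    exact (Int.add_mul_emod_self_left (Z s j) _ _).symm.trans
      (Int.emod_eq_of_lt (by exact_mod_cast hu1) (by exact_mod_cast hu2))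

end Box

/-! ### Non-degeneracy -/

section NonDegenerate

variable {n : ℕ} {F : Type*} [Field F]

/-- Additivity of `h` lets a sum over the support be taken term by term, without knowing that the
columns are distinct. -/
theorem coeff_sum_diagonal {A : Type*} [AddCommMonoid A] (M : Matrix (Fin n) (Fin n) ℤ)
    (a : Fin n → F) (h : (Fin n → ℤ) → F → A) (h0 : ∀ v, h v 0 = 0)
    (hadd : ∀ v c c', h v (c + c') = h v c + h v c') (J : Finset (Fin n)) :
    (∑ j ∈ J, AddMonoidAlgebra.single (column M j) (a j) : Laurent n F).coeff.sum h =
      ∑ j ∈ J, h (column M j) (a j) := by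
  rw [AddMonoidAlgebra.coeff_sum, ← Finsupp.sum_finsetSum_index h0 hadd]
  refine Finset.sum_congr rfl fun j _ => ?_
  rw [AddMonoidAlgebra.coeff_single, Finsupp.sum_single_index (h0 _)]

open Classical in
theorem restrict_diagonal (M : Matrix (Fin n) (Fin n) ℤ) (a : Fin n → F)
    (δ : Set (Fin n → ℝ)) : restrict δ (diagonal M a) =
      ∑ j with toReal (column M j) ∈ δ, AddMonoidAlgebra.single (column M j) (a j) := by
  rw [restrict, Finset.sum_filter, Finset.sum_filter]
  exact coeff_sum_diagonal M a (fun v c => if toReal v ∈ δ then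
    (AddMonoidAlgebra.single v c : Laurent n F) else 0) (by simp)
    (fun v c c' => by split_ifs <;> simp [AddMonoidAlgebra.single_add]) univ

/-- Multiplying by `x i` turns the derivative into `x_i ∂/∂x_i`, which acts on each monomial by the
scalar `M i j`. -/
theorem torusEval_partialDeriv_sum {E : Type*} [Field E] [Algebra F E]
    (M : Matrix (Fin n) (Fin n) ℤ) (a : Fin n → F) (J : Finset (Fin n)) (i : Fin n)
    (x : Fin n → Eˣ) :
    (x i : E) * torusEval (partialDeriv i
      (∑ j ∈ J, AddMonoidAlgebra.single (column M j) (a j) : Laurent n F)) x =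
      ∑ j ∈ J, (M i j : E) * (algebraMap F E (a j) * ((torusPow M x j : Eˣ) : E)) := by
  have h1 : partialDeriv i
      (∑ j ∈ J, AddMonoidAlgebra.single (column M j) (a j) : Laurent n F) =
      ∑ j ∈ J, AddMonoidAlgebra.single (column M j - Pi.single i 1) ((M i j : F) * a j) := by
    rw [partialDeriv]
    exact coeff_sum_diagonal M a (fun v c => (AddMonoidAlgebra.single (v - Pi.single i 1)
      ((v i : F) * c) : Laurent n F)) (by simp)
      (fun v c c' => by rw [mul_add, AddMonoidAlgebra.single_add]) J
  rw [h1, torusEval_sum, Finset.mul_sum]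
  refine Finset.sum_congr rfl fun j _ => ?_
  have h2 : x i * ∏ k, x k ^ (column M j - Pi.single i 1 : Fin n → ℤ) k = torusPow M x j := by
    have h3 : x i = ∏ k, x k ^ (Pi.single i 1 : Fin n → ℤ) k := by
      rw [Finset.prod_eq_single i]
      · simp
      · intro k _ hk
        simp [hk]
      · intro h
        exact absurd (mem_univ i) h
    conv_lhs => rw [h3]
    rw [← Finset.prod_mul_distrib, torusPow]
    refine Finset.prod_congr rfl fun k _ => ?_
    rw [← zpow_add, Pi.sub_apply, add_sub_cancel]
    rfl
  rw [torusEval_single, ← h2, Units.val_mul, Units.coe_prod, map_mul, map_intCast]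
  ring

/-- Otherwise the exposing functional would stay strictly below its maximum on `S`, hence on the
whole hull. -/
theorem exists_mem_of_isExposed {S δ : Set (Fin n → ℝ)} (h : IsExposed ℝ (convexHull ℝ S) δ)
    (hne : δ.Nonempty) : ∃ x ∈ S, x ∈ δ := by
  obtain ⟨l, rfl⟩ := h hne
  obtain ⟨y, hy, hmax⟩ := hne
  by_contra! hcon
  have hlt : convexHull ℝ S ⊆ {x | l x < l y} := by
    refine convexHull_min (fun x hx => ?_) (convex_halfSpace_lt l.toLinearMap.isLinear _)
    refine lt_of_le_of_ne (hmax x (subset_convexHull ℝ S hx)) fun heq => ?_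
    exact hcon x hx ⟨subset_convexHull ℝ S hx, fun z hz => heq ▸ hmax z hz⟩
  exact lt_irrefl (l y) (hlt hy)

theorem nonDegenerate_diagonal {M : Matrix (Fin n) (Fin n) ℤ} (hM : M.det ≠ 0)
    (hMF : (M.det : F) ≠ 0) {a : Fin n → F} (ha : ∀ j, a j ≠ 0) :
    NonDegenerate (diagonal M a) := by
  classical
  rintro δ hδ hne h0 ⟨x, hx⟩
  set K := AlgebraicClosure F
  rw [newtonPolyhedron_eq_convexHull hM ha] at hδ
  obtain ⟨z, hz | ⟨j, rfl⟩, hzδ⟩ := exists_mem_of_isExposed hδ hne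
  · exact h0 (hz ▸ hzδ)
  set J : Finset (Fin n) := univ.filter fun j => toReal (column M j) ∈ δ with hJ
  -- The terms of `f^δ` at `x`, extended by zero. A common zero of the derivatives says that `M`
  -- kills this vector, although its `j`-th entry is nonzero.
  set y : Fin n → K := fun j =>
    if j ∈ J then algebraMap F K (a j) * ((torusPow M x j : Kˣ) : K) else 0 with hy
  have hMy : (M.map (Int.cast : ℤ → K)).mulVec y = 0 := by
    ext i
    have h1 := torusEval_partialDeriv_sum M a J i x
    rw [← restrict_diagonal, hx i, mul_zero] at h1
    rw [Pi.zero_apply, h1, Matrix.mulVec, dotProduct]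
    simp only [hy, mul_ite, mul_zero, Finset.sum_ite_mem, Finset.univ_inter, Matrix.map_apply]
    rfl
  have hdet : (M.map (Int.cast : ℤ → K)).det ≠ 0 := by
    have h1 : (M.map (Int.cast : ℤ → K)).det = (M.det : K) :=
      ((Int.castRingHom K).map_det M).symm
    rw [h1, ← map_intCast (algebraMap F K)]
    exact (map_ne_zero _).2 hMF
  have hy0 := Matrix.eq_zero_of_mulVec_eq_zero hdet hMy
  have hj := congrFun hy0 j
  have hjJ : j ∈ J := mem_filter.2 ⟨mem_univ j, hzδ⟩
  simp only [hy, hjJ, if_true, Pi.zero_apply] at hj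
  rcases mul_eq_zero.1 hj with h | h
  · exact ha j ((map_eq_zero _).1 h)
  · exact (torusPow M x j).ne_zero h

end NonDegenerate

/-! ### The Hodge polygon -/

theorem hodgePolygon_eq {n : ℕ} {R : Type*} [Fintype R] {Δ : Set (Fin n → ℝ)} (κ : R → ℕ)
    (hH : ∀ k, hodgeNumber Δ k = ((univ.filter fun r => κ r = k).card : ℤ)) :
    hodgePolygon Δ = lowerHull (insert (0, 0) {z | ∃ m ≤ n * denominator Δ,
      z = (((univ.filter fun r => κ r ≤ m).card : ℝ),
        (∑ r ∈ univ.filter (fun r => κ r ≤ m), (κ r : ℝ)) / denominator Δ)}) := by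
  classical
  have hfib : ∀ (m k : ℕ), k ∈ range (m + 1) →
      (univ.filter fun r => κ r ≤ m).filter (fun r => κ r = k) =
        univ.filter fun r => κ r = k := by
    intro m k hk
    rw [mem_range] at hk
    ext r
    simp only [mem_filter, mem_univ, true_and]
    omega
  have hmaps : ∀ m : ℕ, ∀ r ∈ univ.filter (fun r => κ r ≤ m), κ r ∈ range (m + 1) := by
    intro m r hr
    rw [mem_range, Nat.lt_succ_iff]
    exact (mem_filter.1 hr).2
  have h1 : ∀ m : ℕ, ∑ k ∈ range (m + 1), (hodgeNumber Δ k : ℝ) =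
      ((univ.filter fun r => κ r ≤ m).card : ℝ) := by
    intro m
    rw [Finset.card_eq_sum_card_fiberwise (hmaps m), Nat.cast_sum]
    refine Finset.sum_congr rfl fun k hk => ?_
    rw [hH, hfib m k hk, Int.cast_natCast]
  have h2 : ∀ m : ℕ, ∑ k ∈ range (m + 1), (k : ℝ) * (hodgeNumber Δ k : ℝ) =
      ∑ r ∈ univ.filter (fun r => κ r ≤ m), (κ r : ℝ) := by
    intro m
    rw [← Finset.sum_fiberwise_of_maps_to (hmaps m)]
    refine Finset.sum_congr rfl fun k hk => ?_
    rw [hH, hfib m k hk, Int.cast_natCast,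
      Finset.sum_congr rfl (g := fun _ => (k : ℝ)) fun r hr => by rw [(mem_filter.1 hr).2],
      Finset.sum_const, nsmul_eq_mul, mul_comm]
  rw [hodgePolygon]
  simp only [h1, h2]

/-- Both the order of `c_s` and the Hodge numbers are read off the box point attached to `s`: `κ s`
is `D` times its level, an integer by the choice of `D`. It is at most `n D` because all coordinates
are below `1`. -/
theorem exists_weight {p n : ℕ} {d : Fin n → ℕ} {M : Matrix (Fin n) (Fin n) ℤ}
    {P Q : Matrix.GeneralLinearGroup (Fin n) ℤ} (hM : M.det ≠ 0)
    (h : (P : Matrix (Fin n) (Fin n) ℤ) * M * (Q : Matrix (Fin n) (Fin n) ℤ) =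
        Matrix.diagonal fun i => (d i : ℤ)) (hp : 1 < p) (hd : ∀ i, d i ∣ p - 1)
    {F : Type*} [Field F] {a : Fin n → F} (ha : ∀ j, a j ≠ 0) :
    ∃ κ : ((i : Fin n) → Fin (d i)) → ℕ,
      (∀ s, (∑ j, (charExponent p (Q : Matrix (Fin n) (Fin n) ℤ) s j : ℝ)) / ((p - 1 : ℕ) : ℝ) =
        κ s / denominator (newtonPolyhedron (diagonal M a))) ∧
      (∀ s, κ s ≤ n * denominator (newtonPolyhedron (diagonal M a))) ∧
      ∀ k, hodgeNumber (newtonPolyhedron (diagonal M a)) k =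
        ((univ.filter fun s => κ s = k).card : ℤ) := by
  classical
  obtain ⟨b, hinj, hcoord, hsurj⟩ := exists_boxPoint hM h hp hd
  obtain ⟨hD, hint⟩ := denominator_spec hM ha
  set D := denominator (newtonPolyhedron (diagonal M a))
  have hD' : (0 : ℝ) < D := by exact_mod_cast hD
  have hp1 : (0 : ℝ) < ((p - 1 : ℕ) : ℝ) := by exact_mod_cast Nat.sub_pos_of_lt hp
  have hnn : ∀ s j, 0 ≤ coords M (toReal (b s)) j := by
    intro s j
    rw [hcoord]
    positivity
  have hlt : ∀ s j, coords M (toReal (b s)) j < 1 := by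
    intro s j
    rw [hcoord, div_lt_one hp1]
    exact_mod_cast charExponent_lt hp _ s j
  have hex : ∀ s, ∃ k : ℕ, level M (toReal (b s)) = k / D := by
    intro s
    obtain ⟨z, hz⟩ := hint (b s)
    have hz0 : 0 ≤ z := by
      have : (0 : ℝ) ≤ z := by
        rw [← hz, level_apply]
        exact mul_nonneg hD'.le (Finset.sum_nonneg fun j _ => hnn s j)
      exact_mod_cast this
    lift z to ℕ using hz0
    refine ⟨z, ?_⟩
    rw [eq_div_iff hD'.ne', mul_comm, hz, Int.cast_natCast]
  choose κ hκ using hex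
  refine ⟨κ, fun s => ?_, fun s => ?_, fun k => ?_⟩
  · rw [← hκ, level_apply, Finset.sum_div]
    exact Finset.sum_congr rfl fun j _ => (hcoord s j).symm
  · have h1 : level M (toReal (b s)) ≤ n := by
      rw [level_apply]
      refine (Finset.sum_le_sum fun j _ => (hlt s j).le).trans ?_
      simp
    rw [hκ, div_le_iff₀ hD'] at h1
    exact_mod_cast h1
  · rw [hodgeNumber_eq_ncard hM ha, Int.natCast_inj, ← Set.ncard_coe_finset,
      ← Set.ncard_image_of_injective _ hinj]
    congr 1
    ext u
    constructor
    · rintro ⟨⟨h1, h2⟩, h3⟩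
      obtain ⟨s, rfl⟩ := hsurj u fun j => ⟨h1 j, h3 j⟩
      refine ⟨s, ?_, rfl⟩
      rw [hκ, div_left_inj' hD'.ne'] at h2
      simpa using (Nat.cast_injective h2 : κ s = k)
    · rintro ⟨s, hs, rfl⟩
      have hs' : κ s = k := by simpa using hs
      exact ⟨⟨hnn s, by rw [hκ, hs']⟩, hlt s⟩

/-- If `p` divided `det M`, it would divide some `d i`, and hence `p - 1`. -/
theorem intCast_det_ne_zero {p n : ℕ} [Fact p.Prime] {F : Type*} [Field F] [CharP F p]
    {d : Fin n → ℕ} {M : Matrix (Fin n) (Fin n) ℤ} {P Q : Matrix.GeneralLinearGroup (Fin n) ℤ}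
    (h : (P : Matrix (Fin n) (Fin n) ℤ) * M * (Q : Matrix (Fin n) (Fin n) ℤ) =
        Matrix.diagonal fun i => (d i : ℤ)) (hd : ∀ i, d i ∣ p - 1) : (M.det : F) ≠ 0 := by
  have hp : p.Prime := Fact.out
  rw [ne_eq, CharP.intCast_eq_zero_iff F p]
  intro hdvd
  have hdet := congrArg Matrix.det h
  rw [Matrix.det_mul, Matrix.det_mul, Matrix.det_diagonal] at hdet
  have h1 : (p : ℤ) ∣ ∏ i, (d i : ℤ) := by
    rw [← hdet]
    exact dvd_mul_of_dvd_left (dvd_mul_of_dvd_right hdvd _) _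
  obtain ⟨i, -, hi⟩ := (Nat.prime_iff_prime_int.1 hp).exists_mem_finset_dvd h1
  have h2 : p ∣ p - 1 := (Int.natCast_dvd_natCast.1 hi).trans (hd i)
  exact Nat.not_dvd_of_pos_of_lt (Nat.sub_pos_of_lt hp.one_lt) (Nat.sub_lt hp.pos one_pos) h2

end ToricExpSum

end

theorem corollary3p5 {n : ℕ} (hn : 0 < n)
    (M : Matrix (Fin n) (Fin n) ℤ) (hM : M.det ≠ 0)
    (d : Fin n → ℕ) (hd : ToricExpSum.IsInvariantFactors M d)
    (p : ℕ) [Fact p.Prime] (hp : p ≡ 1 [MOD d ⟨n - 1, Nat.sub_lt hn Nat.one_pos⟩])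
    {F : Type*} [Field F] [Finite F] [CharP F p]
    (a : Fin n → F) (ha : ∀ j, a j ≠ 0)
    (ζ : PadicAlgCl p) (hζ : IsPrimitiveRoot ζ p) :
    ToricExpSum.IsOrdinary p ζ (ToricExpSum.diagonal M a) := by
  open ToricExpSum in
  let : Algebra (ZMod p) F := ZMod.algebra F p
  obtain ⟨hdvd, P, Q, h⟩ := hd
  have hprime : p.Prime := Fact.out
  have hd1 : ∀ i, d i ∣ p - 1 := fun i =>
    (hdvd i ⟨n - 1, Nat.sub_lt hn Nat.one_pos⟩ (Nat.le_sub_one_of_lt i.isLt)).trans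
      ((Nat.modEq_iff_dvd' hprime.one_lt.le).1 hp.symm)
  set a' : Fin n → Fˣ := fun j => Units.mk0 (a j) (ha j)
  have hL : signedLFunction p ζ (diagonal M a) = ∏ s : (i : Fin n) → Fin (d i),
      (1 - PowerSeries.C (reciprocalZero hζ (Q : Matrix (Fin n) (Fin n) ℤ) a' s) *
        PowerSeries.X) :=
    signedLFunction_eq_prod p ζ _ _ fun k _ => expSum_diagonal hζ h hd1 a' k
  obtain ⟨κ, hκ1, hκ2, hκ3⟩ := exists_weight hM h hprime.one_lt hd1 ha
  refine ⟨nonDegenerate_diagonal hM (intCast_det_ne_zero (p := p) h hd1) ha,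
    affineSpan_newtonPolyhedron hM ha, ⟨∏ s : (i : Fin n) → Fin (d i),
      (1 - Polynomial.C (reciprocalZero hζ (Q : Matrix (Fin n) (Fin n) ℤ) a' s) *
        Polynomial.X), ?_⟩, ?_⟩
  · rw [hL, ← Polynomial.coeToPowerSeries.ringHom_apply, map_prod]
    simp
  · rw [hL, hodgePolygon_eq κ hκ3]
    exact newtonPolygon_prod Finite.one_lt_card _ (reciprocalZero_ne_zero hζ _ a') κ
      (denominator_spec hM ha).1 (fun s => (ordQ_reciprocalZero hζ _ a' s).trans (hκ1 s)) hκ2
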